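/- Let $k$ be a field of any characteristic, let $\mathbb G_m$ and $\mathbb A^1$ be the multiplicative group and the affine line over $k$, and let $Z$ be a smooth affine $k$-scheme equipped with an action of $\mathbb G_m$. Products are taken over $k$. Let $\mathbb X=\operatorname{Spec}k[\tau_1,\tau_2]$, viewed as a scheme over $\mathbb A^1$ via $(\tau_1,\tau_2)\mapsto\tau_1\tau_2$ and equipped with the $\mathbb G_m$-action $\lambda\cdot(\tau_1,\tau_2)=(\lambda\tau_1,\lambda^{-1}\tau_2)$, which preserves this map. For a scheme $S$ over $\mathbb A^1$ put $\mathbb X_S=\mathbb X\times_{\mathbb A^1}S$ with the induced $\mathbb G_m$-action. Let $\widetilde Z$ be the functor on $k$-schemes whose $S$-points are the pairs $(t,f)$, where $t:S\to\mathbb A^1$ is a $k$-morphism and $f:\mathbb X_S\to Z$ is a $\mathbb G_m$-equivariant $k$-morphism ($\mathbb X_S$ being formed with respect to $t$). Let $\widetilde p:\widetilde Z\to\mathbb A^1\times Z\times Z$ be the morphism $(t,f)\mapsto(t,\,f\circ\sigma_1,\,f\circ\sigma_2)$, where $\sigma_1,\sigma_2:S\to\mathbb X_S$ are the sections induced by the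 sections $t\mapsto(1,t)$ and $t\mapsto(t,1)$ of $\mathbb X\to\mathbb A^1$. Let $\Gamma\subset\mathbb G_m\times Z\times Z$ be the graph of the action map $\mathbb G_m\times Z\to Z$, that is, the subscheme of all $(\lambda,z,\lambda z)$, and let $\overline\Gamma$ be its scheme-theoretic closure in $\mathbb A^1\times Z\times Z$. Then $\widetilde p(\widetilde Z)=\overline\Gamma$; that is, $\widetilde p$ induces an isomorphism from $\widetilde Z$ onto the closed subscheme $\overline\Gamma\subset\mathbb A^1\times Z\times Z$ (so in particular $\widetilde Z$ is representable by an affine scheme and $\widetilde p$ is a closed embedding). -/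

import Mathlib

open CategoryTheory MonoidalCategory CartesianMonoidalCategory AlgebraicGeometry Opposite Limits
open scoped LaurentPolynomial MonObj

universe u

noncomputable section

namespace GmInterpolation

variable (k : Type u) [Field k]

/-- The category of `k`-schemes, with its monoidal structure given by fibre products over `k`. -/
abbrev Sch : Type (u + 1) := Over (Spec (CommRingCat.of k))

/-- The multiplicative group over `k`: the spectrum of the Hopf algebra `k[T;T⁻¹]`. -/
abbrev Gm : Sch k := (Spec (CommRingCat.of k[T;T⁻¹])).asOver (Spec (CommRingCat.of k))

/-- The coordinate on the multiplicative group, as an invertible function. -/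
def gmCoord : Γ((Gm k).left, ⊤)ˣ :=
  Units.map (Scheme.ΓSpecIso (CommRingCat.of k[T;T⁻¹])).inv.hom.toMonoidHom
    ⟨LaurentPolynomial.T 1, LaurentPolynomial.T (-1),
      by rw [← LaurentPolynomial.T_add]; simp, by rw [← LaurentPolynomial.T_add]; simp⟩

/-- The affine line over `k`. -/
abbrev A1 : Sch k := Over.mk (𝔸(PUnit.{u + 1}; Spec (CommRingCat.of k)) ↘ Spec (CommRingCat.of k))

/-- The affine plane `𝕏` over `k`; its coordinates `τ₁`, `τ₂` are indexed by `false`, `true`. -/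
abbrev XX : Sch k := Over.mk (𝔸(ULift.{u} Bool; Spec (CommRingCat.of k)) ↘ Spec (CommRingCat.of k))

variable {k}

/-- The `k`-morphism `S ⟶ 𝔸¹` given by a function on `S`. -/
def toA1 {S : Sch k} (a : Γ(S.left, ⊤)) : S ⟶ A1 k :=
  Over.homMk (AffineSpace.homOfVector S.hom fun _ ↦ a)
    (AffineSpace.homOfVector_over _ _)

/-- The `k`-morphism `S ⟶ 𝕏`, `s ↦ (a s, b s)`, given by two functions on `S`. -/
def toXX {S : Sch k} (a b : Γ(S.left, ⊤)) : S ⟶ XX k :=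
  Over.homMk (AffineSpace.homOfVector S.hom fun i ↦ bif i.down then b else a)
    (AffineSpace.homOfVector_over _ _)

variable (k)

/-- The coordinate of the affine line. -/
def tCoord : Γ((A1 k).left, ⊤) := AffineSpace.coord (Spec (CommRingCat.of k)) PUnit.unit

/-- The coordinate `τ₁` of `𝕏`. -/
def τ₁ : Γ((XX k).left, ⊤) := AffineSpace.coord (Spec (CommRingCat.of k)) ⟨false⟩

/-- The coordinate `τ₂` of `𝕏`. -/
def τ₂ : Γ((XX k).left, ⊤) := AffineSpace.coord (Spec (CommRingCat.of k)) ⟨true⟩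

/-- The inclusion of the multiplicative group in the affine line. -/
def gmToA1 : Gm k ⟶ A1 k := toA1 (gmCoord k : Γ((Gm k).left, ⊤))

/-- The family of hyperbolas `𝕏 ⟶ 𝔸¹`, `(τ₁, τ₂) ↦ τ₁ τ₂`. -/
def hyp : XX k ⟶ A1 k := toA1 (τ₁ k * τ₂ k)

/-- The hyperbolic action `λ · (τ₁, τ₂) = (λ τ₁, λ⁻¹ τ₂)` of the multiplicative group on `𝕏`. -/
def hypAct : Gm k ⊗ XX k ⟶ XX k :=
  toXX
    ((fst (Gm k) (XX k)).left.appTop (gmCoord k : Γ((Gm k).left, ⊤)) *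
      (snd (Gm k) (XX k)).left.appTop (τ₁ k))
    ((fst (Gm k) (XX k)).left.appTop ((gmCoord k)⁻¹ : Γ((Gm k).left, ⊤)ˣ).1 *
      (snd (Gm k) (XX k)).left.appTop (τ₂ k))

/-- The section `t ↦ (1, t)` of `𝕏 ⟶ 𝔸¹`. -/
def sec₁ : A1 k ⟶ XX k := toXX 1 (tCoord k)

/-- The section `t ↦ (t, 1)` of `𝕏 ⟶ 𝔸¹`. -/
def sec₂ : A1 k ⟶ XX k := toXX (tCoord k) 1

variable {k}

lemma comp_toA1 {S T : Sch k} (g : T ⟶ S) (a : Γ(S.left, ⊤)) :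
    g ≫ toA1 a = toA1 (g.left.appTop a) := by
  ext1
  simp only [toA1, Over.comp_left, Over.homMk_left, AffineSpace.comp_homOfVector, Over.w]
  rfl

lemma toXX_hyp {S : Sch k} (a b : Γ(S.left, ⊤)) : toXX a b ≫ hyp k = toA1 (a * b) := by
  rw [hyp, comp_toA1, map_mul]
  congr 2 <;> simp [toXX, τ₁, τ₂, -AffineSpace.homOfVector_appTop_coord] <;>
    exact AffineSpace.homOfVector_appTop_coord _ _ _

lemma toA1_tCoord : toA1 (tCoord k) = 𝟙 (A1 k) := by
  ext1
  apply AffineSpace.hom_ext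
  · exact (AffineSpace.homOfVector_over _ _).trans (Category.id_comp _).symm
  · intro i
    refine (AffineSpace.homOfVector_appTop_coord _ _ _).trans ?_
    simp [tCoord]

lemma sec₁_hyp : sec₁ k ≫ hyp k = 𝟙 _ := by
  rw [sec₁, toXX_hyp, one_mul, toA1_tCoord]

lemma sec₂_hyp : sec₂ k ≫ hyp k = 𝟙 _ := by
  rw [sec₂, toXX_hyp, mul_one, toA1_tCoord]

lemma hypAct_hyp : hypAct k ≫ hyp k = snd (Gm k) (XX k) ≫ hyp k := by
  rw [hypAct, toXX_hyp, hyp, comp_toA1]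
  congr 1
  rw [map_mul, mul_mul_mul_comm, ← map_mul, Units.mul_inv, map_one, one_mul]

/-- `𝕏_S = 𝕏 ×_{𝔸¹} S` for a scheme `S` over the affine line via `t`. -/
def XS {S : Sch k} (t : S ⟶ A1 k) : Sch k := pullback (hyp k) t

/-- The projection `𝕏_S ⟶ 𝕏`. -/
def XSfst {S : Sch k} (t : S ⟶ A1 k) : XS t ⟶ XX k := pullback.fst (hyp k) t

/-- The projection `𝕏_S ⟶ S`. -/
def XSsnd {S : Sch k} (t : S ⟶ A1 k) : XS t ⟶ S := pullback.snd (hyp k) t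

lemma XS_condition {S : Sch k} (t : S ⟶ A1 k) : XSfst t ≫ hyp k = XSsnd t ≫ t :=
  pullback.condition

/-- The morphism to `𝕏_S` with given components. -/
def XSlift {S T : Sch k} {t : S ⟶ A1 k} (a : T ⟶ XX k) (b : T ⟶ S) (h : a ≫ hyp k = b ≫ t) :
    T ⟶ XS t := pullback.lift a b h

lemma XSlift_fst {S T : Sch k} {t : S ⟶ A1 k} (a : T ⟶ XX k) (b : T ⟶ S)
    (h : a ≫ hyp k = b ≫ t) : XSlift a b h ≫ XSfst t = a := pullback.lift_fst _ _ _

lemma XSlift_snd {S T : Sch k} {t : S ⟶ A1 k} (a : T ⟶ XX k) (b : T ⟶ S)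
    (h : a ≫ hyp k = b ≫ t) : XSlift a b h ≫ XSsnd t = b := pullback.lift_snd _ _ _

lemma XS_hom_ext {S T : Sch k} {t : S ⟶ A1 k} {f g : T ⟶ XS t}
    (h₁ : f ≫ XSfst t = g ≫ XSfst t) (h₂ : f ≫ XSsnd t = g ≫ XSsnd t) : f = g :=
  pullback.hom_ext h₁ h₂

/-- The action of the multiplicative group on `𝕏_S`, through the factor `𝕏`. -/
def XSAct {S : Sch k} (t : S ⟶ A1 k) : Gm k ⊗ XS t ⟶ XS t :=
  XSlift ((Gm k ◁ XSfst t) ≫ hypAct k) (snd (Gm k) (XS t) ≫ XSsnd t) (by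
    rw [Category.assoc, hypAct_hyp, whiskerLeft_snd_assoc, Category.assoc, XS_condition])

/-- The base change `𝕏_{S'} ⟶ 𝕏_S` of a morphism `g : S' ⟶ S` over the affine line. -/
def XSMap {S S' : Sch k} {t : S ⟶ A1 k} {t' : S' ⟶ A1 k} (g : S' ⟶ S) (h : g ≫ t = t') :
    XS t' ⟶ XS t :=
  XSlift (XSfst t') (XSsnd t' ≫ g) (by rw [Category.assoc, h, XS_condition])

lemma XSAct_XSMap {S S' : Sch k} {t : S ⟶ A1 k} {t' : S' ⟶ A1 k} (g : S' ⟶ S)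
    (h : g ≫ t = t') : XSAct t' ≫ XSMap g h = (Gm k ◁ XSMap g h) ≫ XSAct t := by
  apply XS_hom_ext
  · simp only [XSAct, XSMap, Category.assoc, XSlift_fst]
    rw [← whiskerLeft_comp_assoc, XSlift_fst]
  · simp only [XSAct, XSMap, Category.assoc, XSlift_snd]
    rw [← Category.assoc, XSlift_snd, whiskerLeft_snd_assoc, XSlift_snd, Category.assoc]

lemma XSMap_comp {S S' S'' : Sch k} {t : S ⟶ A1 k} {t' : S' ⟶ A1 k} {t'' : S'' ⟶ A1 k}
    (g : S' ⟶ S) (h : g ≫ t = t') (g' : S'' ⟶ S') (h' : g' ≫ t' = t'') :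
    XSMap g' h' ≫ XSMap g h = XSMap (g' ≫ g) (by rw [Category.assoc, h, h']) := by
  apply XS_hom_ext
  · simp only [XSMap, Category.assoc, XSlift_fst]
  · simp only [XSMap, Category.assoc, XSlift_snd]
    rw [← Category.assoc, XSlift_snd, Category.assoc]

lemma XSMap_eq_id {S : Sch k} (t : S ⟶ A1 k) (g : S ⟶ S) (hg : g = 𝟙 S) (h : g ≫ t = t) :
    XSMap g h = 𝟙 _ := by
  subst hg
  apply XS_hom_ext <;> simp [XSMap, XSlift_fst, XSlift_snd]

/-- The section of `𝕏_S ⟶ S` obtained from a section of `𝕏 ⟶ 𝔸¹` by base change. -/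
def secS {σ : A1 k ⟶ XX k} (hσ : σ ≫ hyp k = 𝟙 _) {S : Sch k} (t : S ⟶ A1 k) : S ⟶ XS t :=
  XSlift (t ≫ σ) (𝟙 S) (by rw [Category.assoc, hσ, Category.comp_id, Category.id_comp])

lemma secS_XSMap {σ : A1 k ⟶ XX k} (hσ : σ ≫ hyp k = 𝟙 _) {S S' : Sch k} {t : S ⟶ A1 k}
    {t' : S' ⟶ A1 k} (g : S' ⟶ S) (h : g ≫ t = t') :
    secS hσ t' ≫ XSMap g h = g ≫ secS hσ t := by
  subst h
  apply XS_hom_ext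
  · simp only [XSMap, secS, Category.assoc, XSlift_fst]
  · simp only [XSMap, secS, Category.assoc, XSlift_snd]
    rw [← Category.assoc, XSlift_snd, Category.id_comp, Category.comp_id]

variable (Z : Sch k) [ModObj (Gm k) Z]

/-- An `S`-point of `Z̃`: a morphism `t : S ⟶ 𝔸¹` together with an equivariant morphism
`𝕏_S ⟶ Z` of `k`-schemes. -/
structure TildePoint (S : Sch k) where
  /-- the morphism to the affine line -/
  t : S ⟶ A1 k
  /-- the morphism to `Z` -/
  f : XS t ⟶ Z
  /-- equivariance of `f` -/
  equivariant : XSAct t ≫ f = (Gm k ◁ f) ≫ γ[Gm k, Z]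

variable {Z}

lemma TildePoint.mk_congr {S : Sch k} {t t' : S ⟶ A1 k} (h : 𝟙 S ≫ t = t') {f : XS t ⟶ Z}
    {f' : XS t' ⟶ Z} (hf : XSMap (𝟙 S) h ≫ f = f')
    (hp : XSAct t ≫ f = (Gm k ◁ f) ≫ γ[Gm k, Z])
    (hq : XSAct t' ≫ f' = (Gm k ◁ f') ≫ γ[Gm k, Z]) :
    TildePoint.mk t f hp = TildePoint.mk t' f' hq := by
  obtain rfl : t = t' := by rw [← h, Category.id_comp]
  rw [XSMap_eq_id _ _ rfl, Category.id_comp] at hf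
  subst hf
  rfl

/-- The pullback of an `S`-point of `Z̃` along `g : S' ⟶ S`. -/
def TildePoint.comap {S S' : Sch k} (g : S' ⟶ S) (p : TildePoint Z S) : TildePoint Z S' where
  t := g ≫ p.t
  f := XSMap g rfl ≫ p.f
  equivariant := by
    rw [← Category.assoc, XSAct_XSMap, Category.assoc, p.equivariant, whiskerLeft_comp_assoc]

lemma TildePoint.comap_id {S : Sch k} (p : TildePoint Z S) : p.comap (𝟙 S) = p := by
  have h : 𝟙 S ≫ 𝟙 S ≫ p.t = p.t := by simp only [Category.id_comp]
  have hf : XSMap (𝟙 S) h ≫ XSMap (𝟙 S) (rfl : 𝟙 S ≫ p.t = 𝟙 S ≫ p.t) ≫ p.f = p.f := by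
    rw [← Category.assoc, XSMap_comp, XSMap_eq_id _ _ (Category.id_comp _), Category.id_comp]
  exact TildePoint.mk_congr h hf _ p.equivariant

lemma TildePoint.comap_comp {S S' S'' : Sch k} (g : S' ⟶ S) (g' : S'' ⟶ S')
    (p : TildePoint Z S) : p.comap (g' ≫ g) = (p.comap g).comap g' := by
  have h : 𝟙 S'' ≫ (g' ≫ g) ≫ p.t = g' ≫ g ≫ p.t := by simp only [Category.id_comp, Category.assoc]
  have hf : XSMap (𝟙 S'') h ≫ XSMap (g' ≫ g) rfl ≫ p.f =
      XSMap g' (rfl : g' ≫ g ≫ p.t = _) ≫ XSMap g rfl ≫ p.f := by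
    rw [← Category.assoc (XSMap (𝟙 S'') h), XSMap_comp, ← Category.assoc (XSMap g' _), XSMap_comp]
    simp only [Category.id_comp]
  exact TildePoint.mk_congr h hf _ _

variable (Z)

/-- The space `Z̃`, as a functor of points on `k`-schemes. -/
def tilde : (Sch k)ᵒᵖ ⥤ Type u where
  obj S := TildePoint Z S.unop
  map g := ↾fun p ↦ p.comap g.unop
  map_id S := by
    ext p
    exact TildePoint.comap_id p
  map_comp g g' := by
    ext p
    exact TildePoint.comap_comp g.unop g'.unop p

/-- The morphism `p̃ : Z̃ ⟶ 𝔸¹ × Z × Z`: its components are the projection to the affine line and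
the restrictions of the universal equivariant map to the sections `(1, t)` and `(t, 1)`. -/
def tildeP : tilde Z ⟶ yoneda.obj (A1 k ⊗ Z ⊗ Z) where
  app S := ↾fun p : TildePoint Z S.unop ↦
    lift p.t (lift (secS sec₁_hyp p.t ≫ p.f) (secS sec₂_hyp p.t ≫ p.f))
  naturality S S' g := by
    ext p
    change lift (g.unop ≫ p.t)
        (lift (secS sec₁_hyp (g.unop ≫ p.t) ≫ XSMap g.unop rfl ≫ p.f)
          (secS sec₂_hyp (g.unop ≫ p.t) ≫ XSMap g.unop rfl ≫ p.f)) =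
      g.unop ≫ lift p.t (lift (secS sec₁_hyp p.t ≫ p.f) (secS sec₂_hyp p.t ≫ p.f))
    rw [← Category.assoc, secS_XSMap, ← Category.assoc (secS sec₂_hyp _), secS_XSMap]
    simp [comp_lift]

/-- The graph `Γ ⟶ 𝔾ₘ × Z × Z`, `(λ, z) ↦ (λ, z, λ · z)`, of the action map. -/
def graph : Gm k ⊗ Z ⟶ Gm k ⊗ Z ⊗ Z :=
  lift (fst _ _) (lift (snd _ _) γ[Gm k, Z])

/-- The graph of the action map, as a morphism to `𝔸¹ × Z × Z`. -/
def graphToA1 : Gm k ⊗ Z ⟶ A1 k ⊗ Z ⊗ Z :=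
  graph Z ≫ (gmToA1 k ▷ (Z ⊗ Z))

/-- The scheme-theoretic closure `Γ̄` of the graph in `𝔸¹ × Z × Z`. -/
def graphClosure : Sch k :=
  Over.mk ((graphToA1 Z).left.imageι ≫ (A1 k ⊗ Z ⊗ Z).hom)

/-- The closed embedding of `Γ̄` in `𝔸¹ × Z × Z`. -/
def graphClosureι : graphClosure Z ⟶ A1 k ⊗ Z ⊗ Z :=
  Over.homMk (graphToA1 Z).left.imageι rfl

end GmInterpolation

end

/-! Write `Z = Spec A`. The action is a ℤ-grading of `A`, and an `S`-point of `Z̃` amounts to a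
triple `(t, u, v)` with `u, v : A → Γ(S)`, where `v = tⁿ u` in degree `n ≥ 0` and `u = tⁿ v` in
degree `-n` (`IsInterpolating`). Indeed the ring of the hyperbola `τ₁ τ₂ = t` embeds in the product
of the Laurent rings of the loci `τ₁ ≠ 0` and `τ₂ ≠ 0`, which are the orbits of the two sections. An
equivariant map is therefore determined by its values `u`, `v` on the sections, and these equations
say exactly that the two orbit maps come from the hyperbola. So `p̃` is injective on points, with
image cut out by the equations.

The graph satisfies the equations, hence so does its closure, whose functions inject into those of
the graph. Smoothness enters in the converse, `IsInterpolating.ambientEval_eq_zero`: an equation `x`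
of the closure vanishes on every triple. Multiplying by some `t^N` eliminates `v`, so `t^N x`
becomes a polynomial in `t` over `A`, which is zero because it vanishes on the graph. It remains to
cancel `t^N`, although `t` may be a zero divisor.

For this, triples are lifted along square-zero extensions with a prescribed lift of `t`
(`IsInterpolating.exists_lift`): formal smoothness lifts `A → R[τ₁, τ₂]/(τ₁ τ₂ - t)`, and the
degree-preserving part of the lift is again a homomorphism. Let `K` be the ideal of the triple in `B
= (A ⊗ A)[X]`. Lifting to `B/K^(d+1)` with `t` lifted to `X`, the value of `x` is killed by `X^N`.
Since `X` is regular in `B`, Artin–Rees puts this value in `K` for large `d`, so `x` vanishes on the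
triple. -/

noncomputable section

namespace GmInterpolation

/-! ### The coordinate ring of the hyperbola and its universal property. -/

section HyperbolaRing

variable {R : Type u} [CommRing R] (t : R)

/-- The pair of restrictions of `τ₁` to the two charts `τ₁ ≠ 0` and `τ₂ ≠ 0` of the hyperbola
`τ₁ τ₂ = t`. -/
def hypX : R[T;T⁻¹] × R[T;T⁻¹] :=
  (LaurentPolynomial.T 1, LaurentPolynomial.C t * LaurentPolynomial.T 1)

/-- The pair of restrictions of `τ₂` to the two charts `τ₁ ≠ 0` and `τ₂ ≠ 0` of the hyperbola
`τ₁ τ₂ = t`. -/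
def hypY : R[T;T⁻¹] × R[T;T⁻¹] :=
  (LaurentPolynomial.C t * LaurentPolynomial.T (-1), LaurentPolynomial.T (-1))

/-- The evaluation of polynomials in two variables at `(hypX t, hypY t)`. -/
def hypEval : MvPolynomial Bool R →ₐ[R] R[T;T⁻¹] × R[T;T⁻¹] :=
  MvPolynomial.aeval fun b ↦ bif b then hypY t else hypX t

/-- The coordinate ring `R[τ₁, τ₂] / (τ₁ τ₂ - t)`, realized as a ring of pairs of Laurent
polynomials. -/
def hypRing : Subalgebra R (R[T;T⁻¹] × R[T;T⁻¹]) := (hypEval t).range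

/-- The functions satisfying the gluing condition between the two charts. -/
def hypCompat : Submodule R (R[T;T⁻¹] × R[T;T⁻¹]) where
  carrier := {x | ∀ n : ℕ, x.2.coeff n = t ^ n * x.1.coeff n ∧
    x.1.coeff (-n) = t ^ n * x.2.coeff (-n)}
  add_mem' {x y} hx hy n := by
    simp only [Prod.fst_add, Prod.snd_add, AddMonoidAlgebra.coeff_add, Finsupp.add_apply,
      hx n, hy n, mul_add, and_self]
  zero_mem' n := by simp
  smul_mem' r x hx n := by
    have := hx n
    simp only [Prod.smul_fst, Prod.smul_snd, AddMonoidAlgebra.coeff_smul, Finsupp.smul_apply,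
      smul_eq_mul, this.1, this.2]
    constructor <;> ring

lemma hypX_pow (n : ℕ) : hypX t ^ n =
    (LaurentPolynomial.T n, LaurentPolynomial.C (t ^ n) * LaurentPolynomial.T n) := by
  simp [hypX, Prod.pow_mk, mul_pow]

lemma hypY_pow (n : ℕ) : hypY t ^ n =
    (LaurentPolynomial.C (t ^ n) * LaurentPolynomial.T (-n), LaurentPolynomial.T (-n)) := by
  simp [hypY, Prod.pow_mk, mul_pow]

lemma hypX_mul_hypY : hypX t * hypY t = algebraMap R _ t := by
  simp only [hypX, hypY, Prod.mk_mul_mk, Prod.algebraMap_apply, LaurentPolynomial.algebraMap_apply]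
  ext1
  · rw [mul_left_comm, ← LaurentPolynomial.T_add]
    simp
  · rw [mul_assoc, ← LaurentPolynomial.T_add]
    simp

lemma hypX_mem : hypX t ∈ hypRing t := ⟨MvPolynomial.X false, by simp [hypEval]⟩

lemma hypY_mem : hypY t ∈ hypRing t := ⟨MvPolynomial.X true, by simp [hypEval]⟩

/-- Cancelling factors `τ₁ τ₂ = t` leaves a pure power of one coordinate, so that later
verifications on monomials reduce to pure powers. -/
lemma hypX_pow_mul_hypY_pow (a b : ℕ) : hypX t ^ a * hypY t ^ b =
    if b ≤ a then t ^ b • hypX t ^ (a - b) else t ^ a • hypY t ^ (b - a) := by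
  split_ifs with h
  · obtain ⟨d, rfl⟩ := Nat.exists_eq_add_of_le h
    rw [add_comm b d, pow_add, mul_assoc, ← mul_pow, hypX_mul_hypY, ← map_pow, mul_comm,
      Nat.add_sub_cancel, Algebra.smul_def]
  · obtain ⟨d, rfl⟩ := Nat.exists_eq_add_of_le (le_of_not_ge h)
    rw [pow_add, ← mul_assoc, ← mul_pow, hypX_mul_hypY, ← map_pow, Nat.add_sub_cancel_left,
      Algebra.smul_def]

lemma hypEval_monomial (m : Bool →₀ ℕ) (r : R) : hypEval t (MvPolynomial.monomial m r) =
    r • (hypX t ^ m false * hypY t ^ m true) := by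
  rw [hypEval, MvPolynomial.aeval_monomial, Finsupp.prod_fintype _ _ (by simp), Algebra.smul_def]
  simp [mul_comm]

lemma hypX_pow_mem_hypCompat (n : ℕ) : hypX t ^ n ∈ hypCompat t := by
  intro m
  rw [hypX_pow]
  simp only [← LaurentPolynomial.single_eq_C_mul_T, AddMonoidAlgebra.coeff_single,
    Finsupp.single_apply, LaurentPolynomial.T_apply]
  refine ⟨by split_ifs with h <;> simp_all, ?_⟩
  split_ifs with h
  · obtain rfl : m = 0 := by omega
    obtain rfl : n = 0 := by omega
    simp
  · simp

lemma hypY_pow_mem_hypCompat (n : ℕ) : hypY t ^ n ∈ hypCompat t := by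
  intro m
  rw [hypY_pow]
  simp only [← LaurentPolynomial.single_eq_C_mul_T, AddMonoidAlgebra.coeff_single,
    Finsupp.single_apply, LaurentPolynomial.T_apply]
  refine ⟨?_, by split_ifs with h <;> simp_all⟩
  split_ifs with h
  · obtain rfl : m = 0 := by omega
    obtain rfl : n = 0 := by omega
    simp
  · simp

lemma hypEval_mem_hypCompat (p : MvPolynomial Bool R) : hypEval t p ∈ hypCompat t := by
  induction p using MvPolynomial.induction_on' with
  | monomial m r =>
    rw [hypEval_monomial, hypX_pow_mul_hypY_pow]
    refine Submodule.smul_mem _ _ ?_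
    split_ifs
    · exact Submodule.smul_mem _ _ (hypX_pow_mem_hypCompat t _)
    · exact Submodule.smul_mem _ _ (hypY_pow_mem_hypCompat t _)
  | add p q hp hq => rw [map_add]; exact add_mem hp hq

section Lift

variable {t} {E : Type*} [CommRing E] [Algebra R E] (x y : E)

/-- The linear map `(f, g) ↦ ∑_{n ≥ 0} fₙ xⁿ + ∑_{n < 0} gₙ y⁻ⁿ`. -/
def hypPsi : R[T;T⁻¹] × R[T;T⁻¹] →ₗ[R] E :=
  LinearMap.coprod
    ((Finsupp.lsum R fun n : ℤ ↦ (LinearMap.toSpanSingleton R E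
      (if 0 ≤ n then x ^ n.toNat else 0))) ∘ₗ
        (AddMonoidAlgebra.coeffLinearEquiv R).toLinearMap)
    ((Finsupp.lsum R fun n : ℤ ↦ (LinearMap.toSpanSingleton R E
      (if n < 0 then y ^ (-n).toNat else 0))) ∘ₗ
        (AddMonoidAlgebra.coeffLinearEquiv R).toLinearMap)

lemma hypPsi_single (r s : R) (m n : ℤ) :
    hypPsi x y (AddMonoidAlgebra.single m r, AddMonoidAlgebra.single n s) =
      (if 0 ≤ m then r • x ^ m.toNat else 0) + (if n < 0 then s • y ^ (-n).toNat else 0) := by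
  simp [hypPsi, -LaurentPolynomial.single_eq_C_mul_T]

lemma hypPsi_hypX_pow (n : ℕ) : hypPsi x y (hypX t ^ n) = x ^ n := by
  rw [hypX_pow, ← LaurentPolynomial.single_eq_C_mul_T, LaurentPolynomial.T, hypPsi_single]
  simp

lemma hypPsi_hypY_pow (n : ℕ) :
    hypPsi x y (hypY t ^ n) = y ^ n := by
  rw [hypY_pow, ← LaurentPolynomial.single_eq_C_mul_T, LaurentPolynomial.T, hypPsi_single]
  -- Constants are read off the first component only, so degree 0 is not counted twice.
  rcases Nat.eq_zero_or_pos n with rfl | h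
  · simp
  · rw [if_neg (by omega), if_pos (by omega)]; simp

/-- Evaluation at `(x, y)` thus depends only on the image under `hypEval`. This makes `hypLift` well
defined and multiplicative without computing the kernel of `hypEval`. -/
lemma hypPsi_hypEval (hxy : x * y = algebraMap R E t) (p : MvPolynomial Bool R) :
    hypPsi x y (hypEval t p) = MvPolynomial.aeval (fun b ↦ bif b then y else x) p := by
  induction p using MvPolynomial.induction_on' with
  | monomial m r =>
    rw [hypEval_monomial, hypX_pow_mul_hypY_pow, MvPolynomial.aeval_monomial,
      Finsupp.prod_fintype _ _ (by simp), map_smul, Algebra.smul_def]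
    congr 1
    simp only [Fintype.prod_bool, cond_true, cond_false]
    split_ifs with h
    · obtain ⟨d, hd⟩ := Nat.exists_eq_add_of_le h
      rw [map_smul, hypPsi_hypX_pow, hd, Nat.add_sub_cancel_left, Algebra.smul_def, map_pow, ← hxy]
      ring
    · obtain ⟨d, hd⟩ := Nat.exists_eq_add_of_le (le_of_not_ge h)
      rw [map_smul, hypPsi_hypY_pow, hd, Nat.add_sub_cancel_left, Algebra.smul_def,
        map_pow, ← hxy]
      ring
  | add p q hp hq => simp only [map_add, hp, hq]

/-- The universal property of the hyperbola ring: a homomorphism is given by two elements with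
product `t`. -/
def hypLift (hxy : x * y = algebraMap R E t) : hypRing t →ₐ[R] E :=
  AlgHom.ofLinearMap (hypPsi x y ∘ₗ (hypRing t).val.toLinearMap)
    (by
      have := hypPsi_hypEval (t := t) x y hxy 1
      simpa using this)
    (by
      rintro ⟨_, p, rfl⟩ ⟨_, q, rfl⟩
      have := hypPsi_hypEval (t := t) x y hxy (p * q)
      rw [map_mul, map_mul (MvPolynomial.aeval _), ← hypPsi_hypEval x y hxy,
        ← hypPsi_hypEval x y hxy] at this
      exact this)

lemma hypLift_X (hxy : x * y = algebraMap R E t) : hypLift x y hxy ⟨hypX t, hypX_mem t⟩ = x := by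
  have := hypPsi_hypX_pow (t := t) x y 1
  rwa [pow_one, pow_one] at this

lemma hypLift_Y (hxy : x * y = algebraMap R E t) : hypLift x y hxy ⟨hypY t, hypY_mem t⟩ = y := by
  have := hypPsi_hypY_pow (t := t) x y 1
  rwa [pow_one, pow_one] at this

end Lift

/-- A compatible pair is the sum of its parts of fixed degree, and each part is a scalar multiple of
a power of `hypX t` or `hypY t`. Membership in the ring thereby becomes a condition on coefficients.
-/
lemma mem_hypRing_iff {x : R[T;T⁻¹] × R[T;T⁻¹]} : x ∈ hypRing t ↔ x ∈ hypCompat t := by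
  refine ⟨fun ⟨p, hp⟩ ↦ hp ▸ hypEval_mem_hypCompat t p, fun hx ↦ ?_⟩
  have h₁ (n : ℕ) (r : R) : (AddMonoidAlgebra.single (n : ℤ) r,
      AddMonoidAlgebra.single (n : ℤ) (t ^ n * r)) ∈ hypRing t := by
    convert (hypRing t).smul_mem (pow_mem (hypX_mem t) n) r using 1
    rw [hypX_pow, ← LaurentPolynomial.single_eq_C_mul_T, LaurentPolynomial.T]
    simp [-LaurentPolynomial.single_eq_C_mul_T, mul_comm]
  have h₂ (n : ℕ) (r : R) : (AddMonoidAlgebra.single (-n : ℤ) (t ^ n * r),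
      AddMonoidAlgebra.single (-n : ℤ) r) ∈ hypRing t := by
    convert (hypRing t).smul_mem (pow_mem (hypY_mem t) n) r using 1
    rw [hypY_pow, ← LaurentPolynomial.single_eq_C_mul_T, LaurentPolynomial.T]
    simp [-LaurentPolynomial.single_eq_C_mul_T, mul_comm]
  have h₃ (n : ℤ) : (AddMonoidAlgebra.single n (x.1.coeff n),
      AddMonoidAlgebra.single n (x.2.coeff n)) ∈ hypRing t := by
    obtain ⟨m, rfl | rfl⟩ := n.eq_nat_or_neg
    · rw [(hx m).1]; exact h₁ _ _
    · rw [(hx m).2]; exact h₂ _ _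
  have h₄ : x = ∑ n ∈ x.1.coeff.support ∪ x.2.coeff.support,
      (AddMonoidAlgebra.single n (x.1.coeff n), AddMonoidAlgebra.single n (x.2.coeff n)) := by
    ext n
    · simp [Prod.fst_sum, AddMonoidAlgebra.coeff_sum, Finsupp.finsetSum_apply,
        Finsupp.single_apply, -LaurentPolynomial.single_eq_C_mul_T]
      tauto
    · simp [Prod.snd_sum, AddMonoidAlgebra.coeff_sum, Finsupp.finsetSum_apply,
        Finsupp.single_apply, -LaurentPolynomial.single_eq_C_mul_T]
  rw [h₄]
  exact sum_mem fun n _ ↦ h₃ n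

end HyperbolaRing

/-! ### Gradings, interpolating triples and their lifting along nilpotent extensions. -/

section Coaction

variable {k : Type u} [CommRing k] {A : Type u} [CommRing A] [Algebra k A]

/-- A coaction of the Hopf algebra of Laurent polynomials: the axioms say that the components of
an element are homogeneous and sum up to the element. -/
structure IsCoaction (c : A →ₐ[k] A[T;T⁻¹]) : Prop where
  sum_coeff (a : A) : (c a).coeff.sum (fun _ b ↦ b) = a
  coeff_homogeneous (a : A) (n : ℤ) :
    c ((c a).coeff n) = AddMonoidAlgebra.single n ((c a).coeff n)

/-- A triple `(t, u, v)` in `R` satisfies the equations of the space of equivariant maps from the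
hyperbola `τ₁ τ₂ = t`: on elements of degree `n ≥ 0` one has `v = tⁿ u`, and on elements of
degree `-n ≤ 0` one has `u = tⁿ v`. -/
def IsInterpolating (c : A →ₐ[k] A[T;T⁻¹]) {R : Type u} [CommRing R] [Algebra k R] (t : R)
    (u v : A →ₐ[k] R) : Prop :=
  ∀ (a : A) (n : ℕ), v ((c a).coeff n) = t ^ n * u ((c a).coeff n) ∧
    u ((c a).coeff (-n)) = t ^ n * v ((c a).coeff (-n))

variable {c : A →ₐ[k] A[T;T⁻¹]} {R : Type u} [CommRing R] [Algebra k R]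

lemma IsCoaction.eq_sum (hc : IsCoaction c) (a : A) :
    a = ∑ n ∈ (c a).coeff.support, (c a).coeff n := (hc.sum_coeff a).symm

lemma laurent_mul_eq_zero {f g : R[T;T⁻¹]} (h : ∀ i j, f.coeff i * g.coeff j = 0) :
    f * g = 0 := by
  classical
  ext n
  rw [AddMonoidAlgebra.coeff_mul]
  simp [Finsupp.sum, h]

/-- Split each factor into its main term and a rest with coefficients in `I`. The product of the
rests vanishes, and the mixed terms do not contribute in degree `m + n` because the rests have
coefficient zero at `m` and `n`. -/
lemma laurent_coeff_mul_add {f g : R[T;T⁻¹]} {I : Ideal R}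
    (hI : ∀ x ∈ I, ∀ y ∈ I, x * y = 0) {m n : ℤ} (hf : ∀ i, i ≠ m → f.coeff i ∈ I)
    (hg : ∀ j, j ≠ n → g.coeff j ∈ I) :
    (f * g).coeff (m + n) = f.coeff m * g.coeff n := by
  have key {f : R[T;T⁻¹]} {m : ℤ} (hf : ∀ i, i ≠ m → f.coeff i ∈ I) :
      ∃ f' : R[T;T⁻¹], f = AddMonoidAlgebra.single m (f.coeff m) + f' ∧ f'.coeff m = 0 ∧
        ∀ i, f'.coeff i ∈ I := by
    refine ⟨f - AddMonoidAlgebra.single m (f.coeff m), by abel, by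
      simp [AddMonoidAlgebra.coeff_sub, -LaurentPolynomial.single_eq_C_mul_T], fun i ↦ ?_⟩
    by_cases h : i = m
    · subst h; simp [AddMonoidAlgebra.coeff_sub, -LaurentPolynomial.single_eq_C_mul_T]
    · simpa [AddMonoidAlgebra.coeff_sub, Finsupp.single_apply, Ne.symm h,
        -LaurentPolynomial.single_eq_C_mul_T] using hf i h
  obtain ⟨f', hf₁, hf₂, hf₃⟩ := key hf
  obtain ⟨g', hg₁, hg₂, hg₃⟩ := key hg
  have h : f' * g' = 0 := laurent_mul_eq_zero fun i j ↦ hI _ (hf₃ i) _ (hg₃ j)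
  have : f * g = AddMonoidAlgebra.single m (f.coeff m) * g +
      f' * AddMonoidAlgebra.single n (g.coeff n) := by
    conv_lhs => rw [hf₁, add_mul]
    congr 1
    conv_lhs => rw [hg₁, mul_add, h, add_zero]
  rw [this, AddMonoidAlgebra.coeff_add, Finsupp.add_apply,
    AddMonoidAlgebra.coeff_single_mul_apply, AddMonoidAlgebra.coeff_mul_single_apply]
  simp [hf₂]

/-- The components of an algebra homomorphism to Laurent polynomials which is homogeneous modulo a
square-zero ideal assemble to an algebra homomorphism. -/
lemma IsCoaction.exists_diagonal (hc : IsCoaction c) (F : A →ₐ[k] R[T;T⁻¹]) (I : Ideal R)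
    (hI : ∀ x ∈ I, ∀ y ∈ I, x * y = 0)
    (hF : ∀ a n m, m ≠ n → (F ((c a).coeff n)).coeff m ∈ I) :
    ∃ w : A →ₐ[k] R, ∀ a n, w ((c a).coeff n) = (F ((c a).coeff n)).coeff n := by
  -- On elements of degree `n`, `w` is the `n`-th coefficient of `F`, the degree-preserving part of
  -- `F`. The error in multiplicativity would consist of products of two off-diagonal coefficients,
  -- which are zero.
  let w : A →ₗ[k] R :=
    (Finsupp.lsum k fun n : ℤ ↦ (Finsupp.lapply n ∘ₗ
      ((AddMonoidAlgebra.coeffLinearEquiv (M := ℤ) (S := R) k).toLinearMap ∘ₗ F.toLinearMap))) ∘ₗ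
      (AddMonoidAlgebra.coeffLinearEquiv (M := ℤ) (S := A) k).toLinearMap ∘ₗ c.toLinearMap
  have hw (a : A) (n : ℤ) (ha : c a = AddMonoidAlgebra.single n a) : w a = (F a).coeff n := by
    simp [w, ha, -LaurentPolynomial.single_eq_C_mul_T]
  have h1 : w 1 = 1 := by
    rw [hw 1 0 (by rw [map_one]; rfl), map_one]
    simp [AddMonoidAlgebra.one_def, -LaurentPolynomial.single_eq_C_mul_T]
  have hmul (a b : A) (m n : ℤ) : w ((c a).coeff m * (c b).coeff n) =
      w ((c a).coeff m) * w ((c b).coeff n) := by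
    have ha := hc.coeff_homogeneous a m
    have hb := hc.coeff_homogeneous b n
    have hFa := hF a m
    have hFb := hF b n
    generalize (c a).coeff m = a at *
    generalize (c b).coeff n = b at *
    rw [hw _ (m + n) (by rw [map_mul, ha, hb, AddMonoidAlgebra.single_mul_single]), hw _ _ ha,
      hw _ _ hb, map_mul]
    exact laurent_coeff_mul_add hI hFa hFb
  refine ⟨AlgHom.ofLinearMap w h1 fun a b ↦ ?_, fun a n ↦ hw _ _ (hc.coeff_homogeneous a n)⟩
  conv_lhs => rw [hc.eq_sum a, hc.eq_sum b, Finset.sum_mul_sum]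
  conv_rhs => rw [hc.eq_sum a, hc.eq_sum b]
  simp only [map_sum, hmul, Finset.sum_mul_sum]

variable {R' : Type u} [CommRing R'] [Algebra k R']

variable (k) in
/-- The inclusion of the hyperbola ring in the pairs of Laurent polynomials, over a base ring. -/
def hypVal (t : R) : hypRing t →ₐ[k] R[T;T⁻¹] × R[T;T⁻¹] where
  __ := (hypRing t).val.toRingHom
  commutes' _ := rfl

/-- The effect of an algebra homomorphism on pairs of Laurent polynomials. -/
def laurentProdMap (π : R →ₐ[k] R') : R[T;T⁻¹] × R[T;T⁻¹] →ₐ[k] R'[T;T⁻¹] × R'[T;T⁻¹] :=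
  AlgHom.prodMap (AddMonoidAlgebra.mapAlgHom ℤ π) (AddMonoidAlgebra.mapAlgHom ℤ π)

lemma laurentProdMap_apply (π : R →ₐ[k] R') (x : R[T;T⁻¹] × R[T;T⁻¹]) : laurentProdMap π x =
    (AddMonoidAlgebra.mapAlgHom ℤ π x.1, AddMonoidAlgebra.mapAlgHom ℤ π x.2) := rfl

lemma laurentProdMap_mem {π : R →ₐ[k] R'} {t : R} {x : R[T;T⁻¹] × R[T;T⁻¹]} (hx : x ∈ hypRing t) :
    laurentProdMap π x ∈ hypRing (π t) := by
  rw [mem_hypRing_iff] at hx ⊢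
  intro n
  simp [laurentProdMap_apply, hx n]

/-- The map of hyperbola rings induced by an algebra homomorphism. -/
def hypRingMap (π : R →ₐ[k] R') (t : R) : hypRing t →ₐ[k] hypRing (π t) :=
  ((laurentProdMap π).comp (hypVal k t)).codRestrict
    ((hypRing (π t)).restrictScalars k) fun x ↦ by
      change laurentProdMap π x.1 ∈ hypRing (π t)
      exact laurentProdMap_mem x.2

lemma hypRingMap_surjective {π : R →ₐ[k] R'} (hπ : Function.Surjective π) (t : R) :
    Function.Surjective (hypRingMap π t) := by
  rintro ⟨_, p', rfl⟩
  obtain ⟨p, rfl⟩ := MvPolynomial.map_surjective (π : R →+* R') hπ p'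
  refine ⟨⟨_, p, rfl⟩, Subtype.ext ?_⟩
  change ((laurentProdMap π).toRingHom.comp (hypEval t).toRingHom) p =
    ((hypEval (π t)).toRingHom.comp (MvPolynomial.map (π : R →+* R'))) p
  congr 1
  refine MvPolynomial.ringHom_ext (fun r ↦ ?_) fun b ↦ ?_
  · ext <;> simp [laurentProdMap_apply, hypEval, apply_ite π]
  · cases b <;> ext <;> simp [laurentProdMap_apply, hypEval, hypX, hypY,
      -LaurentPolynomial.single_eq_C_mul_T, LaurentPolynomial.T, Finsupp.single_apply,
      apply_ite π]

/-- The homomorphism to the hyperbola ring defined by an interpolating triple. -/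
def IsInterpolating.toHypRing {t : R} {u v : A →ₐ[k] R} (h : IsInterpolating c t u v) :
    A →ₐ[k] hypRing t :=
  (((AddMonoidAlgebra.mapAlgHom ℤ u).comp c).prod
    ((AddMonoidAlgebra.mapAlgHom ℤ v).comp c)).codRestrict ((hypRing t).restrictScalars k) fun a ↦ by
      change _ ∈ hypRing t
      rw [mem_hypRing_iff]
      intro n
      simp [h a n]

lemma IsInterpolating.coe_toHypRing {t : R} {u v : A →ₐ[k] R} (h : IsInterpolating c t u v)
    (a : A) : (h.toHypRing a : R[T;T⁻¹] × R[T;T⁻¹]) =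
      (AddMonoidAlgebra.mapAlgHom ℤ u (c a), AddMonoidAlgebra.mapAlgHom ℤ v (c a)) := rfl

/-- Interpolating triples lift along square-zero extensions if `A` is formally smooth. -/
lemma IsInterpolating.exists_lift [Algebra.FormallySmooth k A] (hc : IsCoaction c)
    {π : R →ₐ[k] R'} (hπ : Function.Surjective π)
    (hI : ∀ x ∈ RingHom.ker π, ∀ y ∈ RingHom.ker π, x * y = 0) {t : R}
    {u' v' : A →ₐ[k] R'} (h : IsInterpolating c (π t) u' v') :
    ∃ u v : A →ₐ[k] R, IsInterpolating c t u v ∧ π.comp u = u' ∧ π.comp v = v' := by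
  -- Both components of an element of this kernel have all coefficients in `ker π`, so the kernel
  -- has square zero.
  have hker : IsNilpotent (RingHom.ker (hypRingMap π t)) := by
    refine ⟨2, ?_⟩
    rw [pow_two, Ideal.zero_eq_bot, eq_bot_iff, Ideal.mul_le]
    intro x hx y hy
    have h (x) (hx : x ∈ RingHom.ker (hypRingMap π t)) (i : ℤ) :
        x.1.1.coeff i ∈ RingHom.ker π ∧ x.1.2.coeff i ∈ RingHom.ker π := by
      have hx' : laurentProdMap π x.1 = 0 := congrArg Subtype.val ((RingHom.mem_ker).1 hx)
      have h₁ := congrArg (fun z ↦ z.1.coeff i) hx'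
      have h₂ := congrArg (fun z ↦ z.2.coeff i) hx'
      simpa [laurentProdMap_apply] using And.intro h₁ h₂
    rw [Ideal.mem_bot]
    refine Subtype.ext (Prod.ext ?_ ?_)
    · exact laurent_mul_eq_zero fun i j ↦ hI _ (h x hx i).1 _ (h y hy j).1
    · exact laurent_mul_eq_zero fun i j ↦ hI _ (h x hx i).2 _ (h y hy j).2
  -- The lift `F` need not respect degrees, but it does so modulo `ker π`, as `h.toHypRing` does.
  -- Hence `exists_diagonal` applies to both components.
  let F := Algebra.FormallySmooth.liftOfSurjective h.toHypRing (hypRingMap π t)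
    (hypRingMap_surjective hπ t) hker
  have hF (a : A) : laurentProdMap π (F a).1 = (h.toHypRing a).1 :=
    congrArg Subtype.val (Algebra.FormallySmooth.liftOfSurjective_apply h.toHypRing
      (hypRingMap π t) (hypRingMap_surjective hπ t) hker a)
  have hF₁ (a : A) (n m : ℤ) :
      π ((F ((c a).coeff n)).1.1.coeff m) = if n = m then u' ((c a).coeff n) else 0 := by
    have := congrArg (fun z ↦ z.1.coeff m) (hF ((c a).coeff n))
    simpa [laurentProdMap_apply, coe_toHypRing, hc.coeff_homogeneous, Finsupp.single_apply,
      -LaurentPolynomial.single_eq_C_mul_T, apply_ite u'] using this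
  have hF₂ (a : A) (n m : ℤ) :
      π ((F ((c a).coeff n)).1.2.coeff m) = if n = m then v' ((c a).coeff n) else 0 := by
    have := congrArg (fun z ↦ z.2.coeff m) (hF ((c a).coeff n))
    simpa [laurentProdMap_apply, coe_toHypRing, hc.coeff_homogeneous, Finsupp.single_apply,
      -LaurentPolynomial.single_eq_C_mul_T, apply_ite v'] using this
  obtain ⟨u, hu⟩ := hc.exists_diagonal
    ((AlgHom.fst k _ _).comp ((hypVal k t).comp F)) (RingHom.ker π) hI
    fun a n m hmn ↦ by
      rw [RingHom.mem_ker]; exact (hF₁ a n m).trans (if_neg hmn.symm)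
  obtain ⟨v, hv⟩ := hc.exists_diagonal
    ((AlgHom.snd k _ _).comp ((hypVal k t).comp F)) (RingHom.ker π) hI
    fun a n m hmn ↦ by
      rw [RingHom.mem_ker]; exact (hF₂ a n m).trans (if_neg hmn.symm)
  refine ⟨u, v, fun a n ↦ ?_, ?_, ?_⟩
  -- The values of `F` lie in the hyperbola ring over `t`, and its compatibility conditions in
  -- degrees `n` and `-n` are the required equations.
  · rw [hu, hv, hu, hv]
    exact ⟨((mem_hypRing_iff t).1 (F ((c a).coeff n)).2 n).1,
      ((mem_hypRing_iff t).1 (F ((c a).coeff (-n))).2 n).2⟩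
  · ext a
    rw [hc.eq_sum a, map_sum, map_sum]
    refine Finset.sum_congr rfl fun n _ ↦ ?_
    rw [AlgHom.comp_apply, hu]
    exact (hF₁ a n n).trans (if_pos rfl)
  · ext a
    rw [hc.eq_sum a, map_sum, map_sum]
    refine Finset.sum_congr rfl fun n _ ↦ ?_
    rw [AlgHom.comp_apply, hv]
    exact (hF₂ a n n).trans (if_pos rfl)

/-! ### Equations of the closure of the graph, evaluated on interpolating triples. -/

open scoped TensorProduct

variable (A) in
/-- The coordinate ring of `𝔸¹ × Z × Z` for `Z = Spec A`. -/
abbrev AmbientRing (k : Type u) [CommRing k] [Algebra k A] : Type u := Polynomial (A ⊗[k] A)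

/-- The homomorphism from the ambient ring given by a triple `(t, u, v)`. -/
def ambientEval (t : R) (u v : A →ₐ[k] R) : AmbientRing A k →ₐ[k] R :=
  { Polynomial.eval₂RingHom
      (Algebra.TensorProduct.lift u v fun _ _ ↦ Commute.all _ _ : A ⊗[k] A →ₐ[k] R).toRingHom t with
    commutes' := fun r ↦ by simp [Polynomial.algebraMap_apply] }

lemma ambientEval_apply (t : R) (u v : A →ₐ[k] R) (x : AmbientRing A k) : ambientEval t u v x =
    x.eval₂ (Algebra.TensorProduct.lift u v fun _ _ ↦ Commute.all _ _ : A ⊗[k] A →ₐ[k] R).toRingHom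
      t := rfl

/-- The inclusion of the first factor in the ambient ring. -/
def ambientLeft : A →ₐ[k] AmbientRing A k :=
  (Polynomial.CAlgHom).comp (Algebra.TensorProduct.includeLeft : A →ₐ[k] A ⊗[k] A)

/-- The inclusion of the second factor in the ambient ring. -/
def ambientRight : A →ₐ[k] AmbientRing A k :=
  (Polynomial.CAlgHom).comp (Algebra.TensorProduct.includeRight : A →ₐ[k] A ⊗[k] A)

@[simp] lemma ambientEval_X (t : R) (u v : A →ₐ[k] R) :
    ambientEval t u v Polynomial.X = t := by
  simp [ambientEval_apply]

@[simp] lemma ambientEval_left (t : R) (u v : A →ₐ[k] R) (a : A) :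
    ambientEval t u v (ambientLeft a) = u a := by
  simp [ambientEval_apply, ambientLeft]

@[simp] lemma ambientEval_right (t : R) (u v : A →ₐ[k] R) (a : A) :
    ambientEval t u v (ambientRight a) = v a := by
  simp [ambientEval_apply, ambientRight]

lemma ambient_hom_ext {f g : AmbientRing A k →ₐ[k] R} (hX : f Polynomial.X = g Polynomial.X)
    (hl : ∀ a, f (ambientLeft a) = g (ambientLeft a))
    (hr : ∀ a, f (ambientRight a) = g (ambientRight a)) : f = g := by
  refine Polynomial.algHom_ext' ?_ hX
  ext a
  · exact hl a
  · exact hr a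

lemma IsInterpolating.comp {t : R} {u v : A →ₐ[k] R} (h : IsInterpolating c t u v)
    (π : R →ₐ[k] R') : IsInterpolating c (π t) (π.comp u) (π.comp v) := by
  intro a n
  simp [h a n]

lemma IsInterpolating.of_injective {t : R} {u v : A →ₐ[k] R} {π : R →ₐ[k] R'}
    (hπ : Function.Injective π) (h : IsInterpolating c (π t) (π.comp u) (π.comp v)) :
    IsInterpolating c t u v := by
  intro a n
  refine ⟨hπ ?_, hπ ?_⟩
  · simpa using (h a n).1
  · simpa using (h a n).2

/-- After multiplication with a power of `t`, an element of the ambient ring evaluates on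
interpolating triples like an element of `A[t]`. -/
lemma exists_pow_mul_ambientEval (hc : IsCoaction c) (x : AmbientRing A k) :
    ∃ (N : ℕ) (y : Polynomial A), ∀ (R : Type u) [CommRing R] [Algebra k R] (t : R)
      (u v : A →ₐ[k] R), IsInterpolating c t u v →
        t ^ N * ambientEval t u v x = y.eval₂ (u : A →+* R) t := by
  -- The elements admitting such `N` and `y` form a subalgebra, so it suffices to treat generators.
  let P : Subalgebra k (AmbientRing A k) :=
    { carrier := {x | ∃ (N : ℕ) (y : Polynomial A), ∀ (R : Type u) [CommRing R] [Algebra k R]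
        (t : R) (u v : A →ₐ[k] R), IsInterpolating c t u v →
          t ^ N * ambientEval t u v x = y.eval₂ (u : A →+* R) t}
      mul_mem' := by
        rintro x x' ⟨N, y, h⟩ ⟨N', y', h'⟩
        refine ⟨N + N', y * y', fun R _ _ t u v ht ↦ ?_⟩
        rw [Polynomial.eval₂_mul, ← h R t u v ht, ← h' R t u v ht, map_mul]
        ring
      add_mem' := by
        rintro x x' ⟨N, y, h⟩ ⟨N', y', h'⟩
        refine ⟨N + N', Polynomial.X ^ N' * y + Polynomial.X ^ N * y', fun R _ _ t u v ht ↦ ?_⟩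
        simp only [Polynomial.eval₂_mul, Polynomial.eval₂_add, Polynomial.eval₂_X_pow,
          ← h R t u v ht, ← h' R t u v ht, map_add]
        ring
      algebraMap_mem' := fun r ↦
        ⟨0, Polynomial.C (algebraMap k A r), fun R _ _ t u v _ ↦ by
          rw [AlgHom.commutes]; simp⟩ }
  have hX : Polynomial.X ∈ P := ⟨0, Polynomial.X, fun R _ _ t u v _ ↦ by simp⟩
  have hl (a : A) : ambientLeft a ∈ P := ⟨0, Polynomial.C a, fun R _ _ t u v _ ↦ by simp⟩
  have hr (a : A) : ambientRight a ∈ P := by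
    rw [hc.eq_sum a, map_sum]
    refine sum_mem fun n _ ↦ ?_
    -- In degree `m` one has `v = t^m u` outright; in degree `-m` only `t^m v = u` is available,
    -- which forces the factor `t^N`.
    obtain ⟨m, rfl | rfl⟩ := n.eq_nat_or_neg
    · exact ⟨0, Polynomial.C ((c a).coeff m) * Polynomial.X ^ m, fun R _ _ t u v ht ↦ by
        simp [(ht a m).1, mul_comm (t ^ m)]⟩
    · exact ⟨m, Polynomial.C ((c a).coeff (-m)), fun R _ _ t u v ht ↦ by
        simp [(ht a m).2]⟩
  suffices h : P = ⊤ from (h ▸ Algebra.mem_top : x ∈ P)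
  rw [eq_top_iff]
  intro x _
  induction x using Polynomial.induction_on' with
  | add p q hp hq => exact add_mem (hp trivial) (hq trivial)
  | monomial n z =>
    rw [← Polynomial.C_mul_X_pow_eq_monomial]
    refine mul_mem ?_ (pow_mem hX n)
    clear * - hl hr
    induction z with
    | zero => simp
    | add z w hz hw => rw [map_add]; exact add_mem hz hw
    | tmul a b =>
      have : Polynomial.C (a ⊗ₜ[k] b) = ambientLeft (k := k) a * ambientRight b := by
        simp [ambientLeft, ambientRight, ← Polynomial.C_mul]
      rw [this]
      exact mul_mem (hl a) (hr b)

/-- The universal triple `(T, a, c a)` in `A[T;T⁻¹]` is interpolating. -/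
lemma IsCoaction.isInterpolating (hc : IsCoaction c) :
    IsInterpolating c (LaurentPolynomial.T 1)
      (IsScalarTower.toAlgHom k A A[T;T⁻¹]) c := by
  intro a n
  rw [hc.coeff_homogeneous, hc.coeff_homogeneous, LaurentPolynomial.single_eq_C_mul_T,
    LaurentPolynomial.single_eq_C_mul_T, LaurentPolynomial.T_pow]
  simp only [IsScalarTower.toAlgHom_apply, LaurentPolynomial.C_eq_algebraMap, mul_one]
  refine ⟨mul_comm _ _, ?_⟩
  rw [mul_left_comm, ← LaurentPolynomial.T_add]
  simp

lemma IsInterpolating.exists_lift_quotient [Algebra.FormallySmooth k A] (hc : IsCoaction c)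
    {I J : Ideal R} (hle : J ≤ I) (hIJ : I * I ≤ J) (t : R) {u v : A →ₐ[k] R ⧸ I}
    (h : IsInterpolating c (Ideal.Quotient.mk I t) u v) :
    ∃ u' v' : A →ₐ[k] R ⧸ J, IsInterpolating c (Ideal.Quotient.mk J t) u' v' ∧
      (Ideal.Quotient.factorₐ k hle).comp u' = u ∧
      (Ideal.Quotient.factorₐ k hle).comp v' = v := by
  refine IsInterpolating.exists_lift hc (π := Ideal.Quotient.factorₐ k hle)
    (Ideal.Quotient.factor_surjective hle) ?_ (t := Ideal.Quotient.mk J t) h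
  intro a ha b hb
  obtain ⟨a, rfl⟩ := Ideal.Quotient.mk_surjective a
  obtain ⟨b, rfl⟩ := Ideal.Quotient.mk_surjective b
  replace ha : a ∈ I := Ideal.Quotient.eq_zero_iff_mem.1 ha
  replace hb : b ∈ I := Ideal.Quotient.eq_zero_iff_mem.1 hb
  rw [← map_mul, Ideal.Quotient.eq_zero_iff_mem]
  exact hIJ (Ideal.mul_mem_mul ha hb)

lemma factorₐ_comp_factorₐ {I J L : Ideal R} (h : I ≤ J) (h' : J ≤ L) :
    (Ideal.Quotient.factorₐ k h').comp (Ideal.Quotient.factorₐ k h) =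
      Ideal.Quotient.factorₐ k (h.trans h') :=
  Ideal.Quotient.algHom_ext _ rfl

/-- Interpolating triples lift to infinitesimal neighbourhoods if `A` is formally smooth. -/
lemma IsInterpolating.exists_lift_pow [Algebra.FormallySmooth k A] (hc : IsCoaction c)
    (K : Ideal R) (t : R) {u v : A →ₐ[k] R ⧸ K}
    (h : IsInterpolating c (Ideal.Quotient.mk K t) u v) (n : ℕ) :
    ∃ J : Ideal R, J = K ^ (n + 1) ∧ ∃ hJ : J ≤ K, ∃ u' v' : A →ₐ[k] R ⧸ J,
      IsInterpolating c (Ideal.Quotient.mk J t) u' v' ∧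
      (Ideal.Quotient.factorₐ k hJ).comp u' = u ∧
      (Ideal.Quotient.factorₐ k hJ).comp v' = v := by
  induction n with
  | zero =>
    have hid : Ideal.Quotient.factorₐ k (le_refl K) = AlgHom.id k _ :=
      Ideal.Quotient.algHom_ext _ rfl
    exact ⟨K, by rw [zero_add, pow_one], le_rfl, u, v, h, by rw [hid, AlgHom.id_comp],
      by rw [hid, AlgHom.id_comp]⟩
  | succ n ih =>
    obtain ⟨J, hJ, hJK, u', v', h', hu', hv'⟩ := ih
    obtain ⟨J', hJ'⟩ : ∃ J' : Ideal R, J' = K ^ (n + 1 + 1) := ⟨_, rfl⟩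
    have hle : J' ≤ J := by
      rw [hJ, hJ']; exact Ideal.pow_le_pow_right (Nat.le_succ _)
    -- The extension is square-zero because `2(n + 1) ≥ n + 2`.
    have hJJ : J * J ≤ J' := by
      rw [hJ, hJ', ← pow_add]; exact Ideal.pow_le_pow_right (by omega)
    obtain ⟨u'', v'', h'', hu'', hv''⟩ := h'.exists_lift_quotient hc hle hJJ t
    exact ⟨J', hJ', hle.trans hJK, u'', v'', h'',
      by rw [← hu', ← hu'', ← AlgHom.comp_assoc, factorₐ_comp_factorₐ],
      by rw [← hv', ← hv'', ← AlgHom.comp_assoc, factorₐ_comp_factorₐ]⟩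

/-- In a Noetherian ring, if the product of `z` with a regular element `x` lies in a sufficiently
high power of an ideal, then `z` lies in the ideal. -/
lemma exists_mem_of_mul_mem_pow {R : Type*} [CommRing R] [IsNoetherianRing R] (K : Ideal R) {x : R} (hx : IsRegular x) :
    ∃ d : ℕ, ∀ z, x * z ∈ K ^ (d + 1) → z ∈ K := by
  -- By Artin–Rees, `K^(d+1) ∩ (x) = K (K^d ∩ (x)) ⊆ K (x)`, and the regular element `x` can be
  -- cancelled.
  obtain ⟨d, hd⟩ := Ideal.exists_pow_inf_eq_pow_smul (M := R) K (Ideal.span {x})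
  refine ⟨d, fun z hz ↦ ?_⟩
  have h₁ : x * z ∈ K ^ (d + 1) • (⊤ : Ideal R) ⊓ Ideal.span {x} :=
    ⟨by simpa using hz, Ideal.mul_mem_right _ _ (Ideal.mem_span_singleton_self _)⟩
  rw [hd (d + 1) (Nat.le_succ d), Nat.add_sub_cancel_left, pow_one] at h₁
  have h₂ : x * z ∈ K • Ideal.span {x} := Submodule.smul_mono le_rfl inf_le_right h₁
  obtain ⟨w, hw, hwz⟩ := Submodule.mem_smul_span_singleton.1 h₂
  rw [smul_eq_mul, mul_comm] at hwz
  exact hx.left hwz ▸ hw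

/-- If `A` is smooth, then the equations of the closure of the graph of the coaction hold for all
interpolating triples. -/
theorem IsInterpolating.ambientEval_eq_zero {k : Type u} [Field k] {A : Type u} [CommRing A]
    [Algebra k A] [Algebra.FormallySmooth k A] [Algebra.FiniteType k A] {c : A →ₐ[k] A[T;T⁻¹]}
    (hc : IsCoaction c) {R : Type u} [CommRing R] [Algebra k R] {t : R} {u v : A →ₐ[k] R}
    (h : IsInterpolating c t u v) {x : AmbientRing A k}
    (hx : ambientEval (LaurentPolynomial.T 1) (IsScalarTower.toAlgHom k A A[T;T⁻¹]) c x = 0) :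
    ambientEval t u v x = 0 := by
  have : Algebra.FiniteType k (A ⊗[k] A) := .trans (S := A) inferInstance inferInstance
  have : IsNoetherianRing (A ⊗[k] A) := Algebra.FiniteType.isNoetherianRing k _
  obtain ⟨N, y, hy⟩ := exists_pow_mul_ambientEval hc x
  -- On the universal triple, evaluation of `A[t]` is the inclusion of polynomials in Laurent
  -- polynomials, which is injective.
  have hy0 : y = 0 := by
    have := hy _ _ _ _ hc.isInterpolating
    rw [hx, mul_zero] at this
    have h_eval : Polynomial.toLaurent = Polynomial.eval₂RingHom
        (IsScalarTower.toAlgHom k A A[T;T⁻¹] : A →+* A[T;T⁻¹]) (LaurentPolynomial.T 1) := by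
      refine Polynomial.ringHom_ext (fun a ↦ ?_) ?_
      · simp
      · simp
    rw [← Polynomial.toLaurent_eq_zero, h_eval]
    exact this.symm
  -- The quotient by `K` embeds in `R`, so its tautological triple is interpolating. Passing to the
  -- ambient ring makes the base Noetherian and replaces `t` by the regular element `X`.
  let K : Ideal (AmbientRing A k) := RingHom.ker (ambientEval t u v)
  obtain ⟨d, hd⟩ := exists_mem_of_mul_mem_pow K
    (Polynomial.isRegular_X_pow (R := A ⊗[k] A) N)
  have hK : IsInterpolating c (Ideal.Quotient.mk K Polynomial.X)
      ((Ideal.Quotient.mkₐ k K).comp ambientLeft) ((Ideal.Quotient.mkₐ k K).comp ambientRight) := by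
    refine IsInterpolating.of_injective (R' := R)
      (π := Ideal.kerLiftAlg (ambientEval t u v)) (Ideal.kerLiftAlg_injective _) ?_
    convert h using 1
    · exact ambientEval_X t u v
    · ext a; exact ambientEval_left t u v a
    · ext a; exact ambientEval_right t u v a
  -- The lifts `u'`, `v'` need not be the tautological maps modulo `J`. The value of `x` on the
  -- lifted triple, represented by `z` below, therefore agrees with `x` only modulo `K`, which is
  -- enough.
  obtain ⟨J, hJ, hJK, u', v', h', hu', hv'⟩ := hK.exists_lift_pow hc K Polynomial.X d
  have hfac : (Ideal.Quotient.factorₐ k hJK).comp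
      (ambientEval (Ideal.Quotient.mk J Polynomial.X) u' v') = Ideal.Quotient.mkₐ k K := by
    apply ambient_hom_ext (R := AmbientRing A k ⧸ K)
    · rw [AlgHom.comp_apply, ambientEval_X]; rfl
    · intro a; rw [AlgHom.comp_apply, ambientEval_left]; exact DFunLike.congr_fun hu' a
    · intro a; rw [AlgHom.comp_apply, ambientEval_right]; exact DFunLike.congr_fun hv' a
  obtain ⟨z, hz⟩ := Ideal.Quotient.mk_surjective
    (ambientEval (Ideal.Quotient.mk J Polynomial.X) u' v' x)
  have hz₁ : Polynomial.X ^ N * z ∈ K ^ (d + 1) := by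
    have := hy _ _ _ _ h'
    rw [← hz, hy0, Polynomial.eval₂_zero, ← map_pow, ← map_mul] at this
    rw [← hJ]
    exact Ideal.Quotient.eq_zero_iff_mem.1 this
  have : Ideal.Quotient.mkₐ k K x = 0 := by
    rw [← hfac, AlgHom.comp_apply, ← hz]
    exact Ideal.Quotient.eq_zero_iff_mem.2 (hd z hz₁)
  exact Ideal.Quotient.eq_zero_iff_mem.1 this

end Coaction

end GmInterpolation

end

noncomputable section

namespace GmInterpolation

variable {k : Type u} [Field k]

/-! ### Morphisms to affine schemes as homomorphisms of function algebras. -/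

section Functions

/-- The ring of functions on a `k`-scheme. -/
abbrev Fn (S : Sch k) : Type u := Γ(S.left, ⊤)

instance algebraFn (S : Sch k) : Algebra k (Fn S) :=
  (((Scheme.ΓSpecIso (CommRingCat.of k)).inv ≫ S.hom.appTop).hom : k →+* Fn S).toAlgebra

lemma algebraMap_fn (S : Sch k) (r : k) : algebraMap k (Fn S) r =
    S.hom.appTop ((Scheme.ΓSpecIso (CommRingCat.of k)).inv r) := rfl

/-- The pullback of functions. -/
def pull {S T : Sch k} (g : T ⟶ S) : Fn S →ₐ[k] Fn T where
  __ := (g.left.appTop.hom : Fn S →+* Fn T)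
  commutes' r := by
    change g.left.appTop (algebraMap k (Fn S) r) = _
    rw [algebraMap_fn, algebraMap_fn, ← CommRingCat.comp_apply, ← Scheme.Hom.comp_appTop]
    have := Over.w g
    exact congrArg (fun h : T.left ⟶ _ ↦ h.appTop _) this

lemma pull_apply {S T : Sch k} (g : T ⟶ S) (a : Fn S) : pull g a = g.left.appTop a := rfl

lemma pull_comp {S T U : Sch k} (f : T ⟶ S) (g : U ⟶ T) :
    pull (g ≫ f) = (pull g).comp (pull f) := by
  ext a
  exact congrArg (fun h : Γ(S.left, ⊤) ⟶ Γ(U.left, ⊤) ↦ h a)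
    (Scheme.Hom.comp_appTop g.left f.left)

lemma pull_comp_apply {S T U : Sch k} (f : T ⟶ S) (g : U ⟶ T) (a : Fn S) :
    pull (g ≫ f) a = pull g (pull f a) := by
  rw [pull_comp]; rfl

lemma pull_id (S : Sch k) : pull (𝟙 S) = AlgHom.id k _ := by
  ext a
  simp [pull_apply]

lemma hom_ext_of_pull {Z T : Sch k} [IsAffine Z.left] {f g : T ⟶ Z} (h : pull f = pull g) :
    f = g := by
  ext1
  apply ext_of_isAffine
  ext a
  exact DFunLike.congr_fun h a

lemma exists_pull_eq {Z T : Sch k} [IsAffine Z.left] (φ : Fn Z →ₐ[k] Fn T) :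
    ∃ f : T ⟶ Z, pull f = φ := by
  obtain ⟨g, h⟩ : ∃ g : T.left ⟶ Z.left, g ≫ Z.left.toSpecΓ =
      T.left.toSpecΓ ≫ Spec.map (CommRingCat.ofHom φ.toRingHom) :=
    ⟨T.left.toSpecΓ ≫ Spec.map (CommRingCat.ofHom φ.toRingHom) ≫ inv Z.left.toSpecΓ, by simp⟩
  have hg : g.appTop = CommRingCat.ofHom φ.toRingHom := by
    have h' := congrArg Scheme.Hom.appTop h
    rw [Scheme.Hom.comp_appTop, Scheme.Hom.comp_appTop, Scheme.toSpecΓ_appTop,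
      Scheme.toSpecΓ_appTop, Scheme.ΓSpecIso_naturality] at h'
    exact (cancel_epi _).1 h'
  refine ⟨Over.homMk g ?_, ?_⟩
  · apply ext_of_isAffine
    rw [Scheme.Hom.comp_appTop, hg, ← cancel_epi (Scheme.ΓSpecIso (CommRingCat.of k)).inv]
    ext r
    exact φ.commutes r
  · ext a
    exact congrArg (fun h : Γ(Z.left, ⊤) ⟶ Γ(T.left, ⊤) ↦ h a) hg

/-- The morphism to an affine scheme given by a homomorphism of function rings. -/
def ofFn {Z T : Sch k} [IsAffine Z.left] (φ : Fn Z →ₐ[k] Fn T) : T ⟶ Z :=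
  (exists_pull_eq φ).choose

lemma pull_ofFn {Z T : Sch k} [IsAffine Z.left] (φ : Fn Z →ₐ[k] Fn T) : pull (ofFn φ) = φ :=
  (exists_pull_eq φ).choose_spec

variable (k) in
/-- The spectrum of a `k`-algebra. -/
def SpecO (B : Type u) [CommRing B] [Algebra k B] : Sch k :=
  Over.mk (Spec.map (CommRingCat.ofHom (algebraMap k B)))

instance (B : Type u) [CommRing B] [Algebra k B] : IsAffine (SpecO k B).left :=
  inferInstanceAs (IsAffine (Spec _))

variable (k) in
/-- The functions on the spectrum of an algebra. -/
def specFn (B : Type u) [CommRing B] [Algebra k B] : Fn (SpecO k B) ≃ₐ[k] B :=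
  AlgEquiv.symm
    { (Scheme.ΓSpecIso (CommRingCat.of B)).symm.commRingCatIsoToRingEquiv with
      commutes' := fun r ↦ by
        exact congrArg (fun h : CommRingCat.of k ⟶ _ ↦ h r)
          (Scheme.ΓSpecIso_inv_naturality (CommRingCat.ofHom (algebraMap k B))) }

lemma specFn_symm_apply (B : Type u) [CommRing B] [Algebra k B] (b : B) :
    (specFn k B).symm b = (Scheme.ΓSpecIso (CommRingCat.of B)).inv b := rfl

/-- The morphism to a spectrum given by an algebra homomorphism. -/
def toSpecO {B : Type u} [CommRing B] [Algebra k B] {T : Sch k} (φ : B →ₐ[k] Fn T) :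
    T ⟶ SpecO k B := ofFn (φ.comp (specFn k B).toAlgHom)

lemma pull_toSpecO {B : Type u} [CommRing B] [Algebra k B] {T : Sch k} (φ : B →ₐ[k] Fn T) (b : B) :
    pull (toSpecO φ) ((specFn k B).symm b) = φ b := by
  rw [toSpecO, pull_ofFn]
  simp

lemma pull_toSpecO' {B : Type u} [CommRing B] [Algebra k B] {T : Sch k} (φ : B →ₐ[k] Fn T)
    (b : Fn (SpecO k B)) : pull (toSpecO φ) b = φ (specFn k B b) := by
  rw [toSpecO, pull_ofFn]
  simp

end Functions

/-! ### Coordinates on the affine line, the plane and the multiplicative group. -/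

section Coordinates

lemma pull_toA1 {S : Sch k} (a : Fn S) : pull (toA1 a) (tCoord k) = a :=
  AffineSpace.homOfVector_appTop_coord _ _ _

lemma toA1_pull {S : Sch k} (t : S ⟶ A1 k) : toA1 (pull t (tCoord k)) = t := by
  have := comp_toA1 t (tCoord k)
  rw [toA1_tCoord, Category.comp_id] at this
  exact this.symm

lemma pull_toXX_τ₁ {S : Sch k} (a b : Fn S) : pull (toXX a b) (τ₁ k) = a :=
  AffineSpace.homOfVector_appTop_coord _ _ _

lemma pull_toXX_τ₂ {S : Sch k} (a b : Fn S) : pull (toXX a b) (τ₂ k) = b :=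
  AffineSpace.homOfVector_appTop_coord _ _ _

lemma XX_hom_ext {S : Sch k} {f g : S ⟶ XX k} (h₁ : pull f (τ₁ k) = pull g (τ₁ k))
    (h₂ : pull f (τ₂ k) = pull g (τ₂ k)) : f = g := by
  ext1
  apply AffineSpace.hom_ext
  · exact (Over.w f).trans (Over.w g).symm
  · rintro ⟨_ | _⟩
    · exact h₁
    · exact h₂

lemma pull_hyp : pull (hyp k) (tCoord k) = τ₁ k * τ₂ k := pull_toA1 _

/-- The morphism to the multiplicative group given by an invertible function. -/
def toGm {T : Sch k} (l : (Fn T)ˣ) : T ⟶ Gm k :=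
  toSpecO (B := k[T;T⁻¹])
    { LaurentPolynomial.eval₂ (algebraMap k (Fn T)) l with
      commutes' := fun r ↦ by
        change LaurentPolynomial.eval₂ (algebraMap k (Fn T)) l (algebraMap k _ r) = _
        rw [LaurentPolynomial.algebraMap_apply]
        simp }

lemma gmCoord_eq : (gmCoord k : Fn (Gm k)) = (specFn k k[T;T⁻¹]).symm (LaurentPolynomial.T 1) := rfl

lemma pull_toGm {T : Sch k} (l : (Fn T)ˣ) : pull (toGm l) (gmCoord k : Fn (Gm k)) = l := by
  rw [gmCoord_eq]
  refine (pull_toSpecO _ _).trans ?_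
  change LaurentPolynomial.eval₂ (algebraMap k (Fn T)) l _ = _
  simp

instance : IsAffine (Gm k).left := inferInstanceAs (IsAffine (Spec _))

lemma laurent_algHom_ext {E : Type*} [CommRing E] [Algebra k E] {f g : k[T;T⁻¹] →ₐ[k] E}
    (h : f (LaurentPolynomial.T 1) = g (LaurentPolynomial.T 1)) : f = g := by
  have hpos (m : ℕ) : f (LaurentPolynomial.T m) = g (LaurentPolynomial.T m) := by
    have : (LaurentPolynomial.T m : k[T;T⁻¹]) = LaurentPolynomial.T 1 ^ m := by
      rw [LaurentPolynomial.T_pow, mul_one]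
    rw [this, map_pow, map_pow, h]
  refine AddMonoidAlgebra.algHom_ext (R := k) (M := ℤ) (fun n ↦ ?_) (by ext)
  obtain ⟨m, rfl | rfl⟩ := n.eq_nat_or_neg
  · exact hpos m
  · change f (LaurentPolynomial.T (-m)) = g (LaurentPolynomial.T (-m))
    have hm : (LaurentPolynomial.T (-m) : k[T;T⁻¹]) * LaurentPolynomial.T m = 1 := by
      rw [← LaurentPolynomial.T_add]; simp
    have hf : f (LaurentPolynomial.T (-m)) * f (LaurentPolynomial.T m) = 1 := by
      rw [← map_mul, hm, map_one]
    have hg : f (LaurentPolynomial.T m) * g (LaurentPolynomial.T (-m)) = 1 := by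
      rw [hpos, ← map_mul, mul_comm, hm, map_one]
    exact left_inv_eq_right_inv hf hg

lemma Gm_hom_ext {T : Sch k} {f g : T ⟶ Gm k}
    (h : pull f (gmCoord k : Fn (Gm k)) = pull g (gmCoord k : Fn (Gm k))) : f = g := by
  apply hom_ext_of_pull (Z := Gm k)
  have key : (pull f).comp (specFn k k[T;T⁻¹]).symm.toAlgHom =
      (pull g).comp (specFn k k[T;T⁻¹]).symm.toAlgHom := laurent_algHom_ext h
  ext a
  have := DFunLike.congr_fun key (specFn k k[T;T⁻¹] a)
  have ha : (specFn k k[T;T⁻¹]).symm (specFn k k[T;T⁻¹] a) = a := AlgEquiv.symm_apply_apply _ _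
  exact (congrArg (pull f) ha).symm.trans (this.trans (congrArg (pull g) ha))

/-- The invertible function defining a morphism to the multiplicative group. -/
def gmUnit {T : Sch k} (l : T ⟶ Gm k) : (Fn T)ˣ := Units.map (pull l : Fn (Gm k) →* Fn T) (gmCoord k)

lemma coe_gmUnit {T : Sch k} (l : T ⟶ Gm k) :
    (gmUnit l : Fn T) = pull l (gmCoord k : Fn (Gm k)) := rfl

lemma gmUnit_toGm {T : Sch k} (l : (Fn T)ˣ) : gmUnit (toGm l) = l := by
  ext1
  rw [coe_gmUnit, pull_toGm]

lemma appTop_comp_specMap {B C : Type u} [CommRing B] [CommRing C] {X : Scheme.{u}}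
    (f : X ⟶ Spec (CommRingCat.of C)) (φ : B →+* C) (b : B) :
    (f ≫ Spec.map (CommRingCat.ofHom φ)).appTop ((Scheme.ΓSpecIso (CommRingCat.of B)).inv b) =
      f.appTop ((Scheme.ΓSpecIso (CommRingCat.of C)).inv (φ b)) := by
  rw [Scheme.Hom.comp_appTop, CommRingCat.comp_apply]
  congr 1
  exact congrArg (fun h : CommRingCat.of B ⟶ _ ↦ h b)
    (Scheme.ΓSpecIso_inv_naturality (CommRingCat.ofHom φ)).symm

lemma appTop_comp_specMap_of_eq_tmul {B : Type u} [CommRing B] [Algebra k B] {X : Scheme.{u}}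
    (e : X ⟶ Spec (CommRingCat.of (TensorProduct k B B))) (φ : B →ₐ[k] TensorProduct k B B) {b : B}
    (h : φ b = b ⊗ₜ[k] b) :
    (e ≫ Spec.map (CommRingCat.ofHom φ.toRingHom)).appTop
        ((Scheme.ΓSpecIso (CommRingCat.of B)).inv b) =
      (e ≫ Spec.map (CommRingCat.ofHom Algebra.TensorProduct.includeLeftRingHom)).appTop
        ((Scheme.ΓSpecIso (CommRingCat.of B)).inv b) *
      (e ≫ Spec.map (CommRingCat.ofHom
        (Algebra.TensorProduct.includeRight : B →ₐ[k] TensorProduct k B B).toRingHom)).appTop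
        ((Scheme.ΓSpecIso (CommRingCat.of B)).inv b) := by
  rw [appTop_comp_specMap, appTop_comp_specMap, appTop_comp_specMap, ← map_mul, ← map_mul]
  congr 2
  simp [h]

/-- The coordinate is group-like: comultiplication sends `T` to `T ⊗ T`. -/
lemma pull_gm_mul : pull μ[Gm k] (gmCoord k : Fn (Gm k)) =
    pull (fst (Gm k) (Gm k)) (gmCoord k : Fn (Gm k)) *
      pull (snd (Gm k) (Gm k)) (gmCoord k : Fn (Gm k)) := by
  let e : (Gm k ⊗ Gm k).left ⟶ Spec (CommRingCat.of (TensorProduct k k[T;T⁻¹] k[T;T⁻¹])) :=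
    (pullbackSpecIso k k[T;T⁻¹] k[T;T⁻¹]).hom
  have e₀ : μ[Gm k].left = e ≫ Spec.map (CommRingCat.ofHom
      (Bialgebra.comulAlgHom k k[T;T⁻¹]).toRingHom) := mul_spec_asOver_spec_left
  have e₁ : (fst (Gm k) (Gm k)).left = e ≫ Spec.map (CommRingCat.ofHom
      Algebra.TensorProduct.includeLeftRingHom) :=
    (pullbackSpecIso_hom_fst k k[T;T⁻¹] k[T;T⁻¹]).symm
  have e₂ : (snd (Gm k) (Gm k)).left = e ≫ Spec.map (CommRingCat.ofHom
      (Algebra.TensorProduct.includeRight :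
        k[T;T⁻¹] →ₐ[k] TensorProduct k k[T;T⁻¹] k[T;T⁻¹]).toRingHom) :=
    (pullbackSpecIso_hom_snd k k[T;T⁻¹] k[T;T⁻¹]).symm
  rw [pull_apply, pull_apply, pull_apply, e₀, e₁, e₂, gmCoord_eq, specFn_symm_apply]
  exact appTop_comp_specMap_of_eq_tmul e _ (LaurentPolynomial.comul_T 1)

lemma pull_gm_one : pull η[Gm k] (gmCoord k : Fn (Gm k)) = 1 := by
  have e₀ : η[Gm k].left = 𝟙 _ ≫ Spec.map (CommRingCat.ofHom
      (Bialgebra.counitAlgHom k k[T;T⁻¹]).toRingHom) := (Category.id_comp _).symm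
  rw [pull_apply, e₀, gmCoord_eq, specFn_symm_apply]
  erw [appTop_comp_specMap]
  simp

end Coordinates

/-! ### From an action of the multiplicative group to a coaction. -/

section Action

/-- The evaluation of Laurent polynomials at an invertible element. -/
def laurentEval {A E : Type u} [CommRing A] [CommRing E] [Algebra k A] [Algebra k E]
    (φ : A →ₐ[k] E) (x : Eˣ) : A[T;T⁻¹] →ₐ[k] E where
  __ := LaurentPolynomial.eval₂ (φ : A →+* E) x
  commutes' r := by
    change LaurentPolynomial.eval₂ (φ : A →+* E) x (algebraMap k _ r) = _
    rw [LaurentPolynomial.algebraMap_apply]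
    simp

lemma laurentEval_single {A E : Type u} [CommRing A] [CommRing E] [Algebra k A] [Algebra k E]
    (φ : A →ₐ[k] E) (x : Eˣ) (n : ℤ) (a : A) :
    laurentEval φ x (AddMonoidAlgebra.single n a) = φ a * (x ^ n : Eˣ) := by
  rw [LaurentPolynomial.single_eq_C_mul_T]
  exact LaurentPolynomial.eval₂_C_mul_T _ _ _ _

lemma laurentEval_eq_sum {A E : Type u} [CommRing A] [CommRing E] [Algebra k A] [Algebra k E]
    (φ : A →ₐ[k] E) (x : Eˣ) (f : A[T;T⁻¹]) :
    laurentEval φ x f = f.coeff.sum fun n a ↦ φ a * (x ^ n : Eˣ) := by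
  conv_lhs => rw [← AddMonoidAlgebra.sum_coeff_single f]
  rw [Finsupp.sum, map_sum]
  simp only [laurentEval_single, Finsupp.sum]

lemma map_laurentEval {A E E' : Type u} [CommRing A] [CommRing E] [CommRing E'] [Algebra k A]
    [Algebra k E] [Algebra k E'] (ψ : E →ₐ[k] E') (φ : A →ₐ[k] E) (x : Eˣ) (f : A[T;T⁻¹]) :
    ψ (laurentEval φ x f) = laurentEval (ψ.comp φ) (Units.map (ψ : E →* E') x) f := by
  simp only [laurentEval_eq_sum, Finsupp.sum, map_sum, map_mul, AlgHom.comp_apply, ← map_zpow]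
  rfl

variable (Z : Sch k) [ModObj (Gm k) Z] {T : Sch k}

variable {Z} in
lemma one_act (z : T ⟶ Z) : lift (toUnit T ≫ η[Gm k]) z ≫ γ[Gm k, Z] = z := by
  have h : lift (toUnit T) z ≫ η[Gm k] ▷ Z ≫ γ[Gm k, Z] = lift (toUnit T) z ≫ (λ_ Z).hom :=
    lift (toUnit T) z ≫= ModObj.one_smul (M := Gm k) Z
  rwa [lift_whiskerRight_assoc, lift_leftUnitor_hom] at h

variable {Z} in
lemma mul_act (a b : T ⟶ Gm k) (z : T ⟶ Z) :
    lift (lift a b ≫ μ[Gm k]) z ≫ γ[Gm k, Z] = lift a (lift b z ≫ γ[Gm k, Z]) ≫ γ[Gm k, Z] := by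
  have h : lift (lift a b) z ≫ μ[Gm k] ▷ Z ≫ γ[Gm k, Z] =
      lift (lift a b) z ≫ (α_ _ _ _).hom ≫ Gm k ◁ γ[Gm k, Z] ≫ γ[Gm k, Z] :=
    lift (lift a b) z ≫= ModObj.mul_smul (M := Gm k) Z
  rwa [lift_whiskerRight_assoc, lift_lift_associator_hom_assoc, lift_whiskerLeft_assoc] at h

variable [IsAffine Z.left]

/-- The variable, as an invertible Laurent polynomial. -/
def unitT (A : Type u) [CommRing A] : A[T;T⁻¹]ˣ :=
  ⟨LaurentPolynomial.T 1, LaurentPolynomial.T (-1),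
    by rw [← LaurentPolynomial.T_add]; simp, by rw [← LaurentPolynomial.T_add]; simp⟩

lemma unitT_zpow (A : Type u) [CommRing A] (n : ℤ) :
    ((unitT A ^ n : A[T;T⁻¹]ˣ) : A[T;T⁻¹]) = AddMonoidAlgebra.single n 1 := by
  change _ = LaurentPolynomial.T n
  obtain ⟨m, rfl | rfl⟩ := n.eq_nat_or_neg
  · rw [zpow_natCast, Units.val_pow_eq_pow_val]
    change LaurentPolynomial.T 1 ^ m = _
    rw [LaurentPolynomial.T_pow, mul_one]
  · rw [zpow_neg, zpow_natCast, ← inv_pow, Units.val_pow_eq_pow_val]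
    change LaurentPolynomial.T (-1) ^ m = _
    rw [LaurentPolynomial.T_pow, mul_neg_one]

/-- The universal point of the multiplicative group over `Spec A[T;T⁻¹]`. -/
def univGm : SpecO k (Fn Z)[T;T⁻¹] ⟶ Gm k :=
  toGm (Units.map ((specFn k (Fn Z)[T;T⁻¹]).symm : _ →* Fn (SpecO k (Fn Z)[T;T⁻¹]))
    (unitT (Fn Z)))

/-- The universal point of `Z` over `Spec A[T;T⁻¹]`. -/
def univPt : SpecO k (Fn Z)[T;T⁻¹] ⟶ Z :=
  ofFn ((specFn k (Fn Z)[T;T⁻¹]).symm.toAlgHom.comp (IsScalarTower.toAlgHom k (Fn Z) (Fn Z)[T;T⁻¹]))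

/-- The coaction defined by an action of the multiplicative group on an affine scheme. -/
def coact : Fn Z →ₐ[k] (Fn Z)[T;T⁻¹] :=
  (specFn k (Fn Z)[T;T⁻¹]).toAlgHom.comp (pull (lift (univGm Z) (univPt Z) ≫ γ[Gm k, Z]))

variable {Z}

/-- Every pair `(l, z)` is pulled back from the universal pair over `Spec A[T;T⁻¹]`, on which the
action is `coact` by definition. -/
lemma pull_act (l : T ⟶ Gm k) (z : T ⟶ Z) :
    pull (lift l z ≫ γ[Gm k, Z]) = (laurentEval (pull z) (gmUnit l)).comp (coact Z) := by
  let g : T ⟶ SpecO k (Fn Z)[T;T⁻¹] := toSpecO (laurentEval (pull z) (gmUnit l))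
  have h₁ : g ≫ univGm Z = l := by
    apply Gm_hom_ext
    rw [pull_comp_apply, univGm, pull_toGm]
    refine (pull_toSpecO _ _).trans ?_
    have := laurentEval_single (pull z) (gmUnit l) 1 1
    rw [map_one, one_mul, zpow_one] at this
    exact this
  have h₂ : g ≫ univPt Z = z := by
    apply hom_ext_of_pull
    ext a
    rw [pull_comp_apply, univPt, pull_ofFn]
    refine (pull_toSpecO _ _).trans ?_
    have := laurentEval_single (pull z) (gmUnit l) 0 a
    rw [zpow_zero, Units.val_one, mul_one] at this
    exact this
  have h₃ : lift l z = g ≫ lift (univGm Z) (univPt Z) := by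
    rw [comp_lift, h₁, h₂]
  rw [h₃, Category.assoc, pull_comp]
  ext a
  simp [coact, g, pull_toSpecO']

lemma gmUnit_one : gmUnit (toUnit T ≫ η[Gm k]) = 1 := by
  ext1
  rw [coe_gmUnit, pull_comp_apply, pull_gm_one, map_one, Units.val_one]

lemma gmUnit_mul (l m : T ⟶ Gm k) : gmUnit (lift l m ≫ μ[Gm k]) = gmUnit l * gmUnit m := by
  ext1
  rw [coe_gmUnit, pull_comp_apply, pull_gm_mul, map_mul, ← pull_comp_apply, ← pull_comp_apply,
    lift_fst, lift_snd, Units.val_mul, coe_gmUnit, coe_gmUnit]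

/-- This is associativity of the action on points over `Spec E`. -/
lemma laurentEval_mul_coact {E : Type u} [CommRing E] [Algebra k E] (φ : Fn Z →ₐ[k] E)
    (l m : Eˣ) (a : Fn Z) : laurentEval φ (l * m) (coact Z a) =
      laurentEval ((laurentEval φ m).comp (coact Z)) l (coact Z a) := by
  let σ : E →ₐ[k] Fn (SpecO k E) := (specFn k E).symm.toAlgHom
  apply (specFn k E).symm.injective
  change σ _ = σ _
  rw [map_laurentEval, map_laurentEval, ← AlgHom.comp_assoc]
  have hσ : σ.comp (laurentEval φ m) =
      laurentEval (σ.comp φ) (Units.map (σ : E →* Fn (SpecO k E)) m) :=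
    AlgHom.ext fun f ↦ map_laurentEval σ φ m f
  rw [hσ, map_mul]
  let z : SpecO k E ⟶ Z := ofFn (σ.comp φ)
  have hz : pull z = σ.comp φ := pull_ofFn _
  have h := congrArg pull (mul_act (toGm (Units.map (σ : E →* Fn (SpecO k E)) l))
    (toGm (Units.map (σ : E →* Fn (SpecO k E)) m)) z)
  rw [pull_act, pull_act, pull_act, gmUnit_mul, gmUnit_toGm, gmUnit_toGm, hz] at h
  exact DFunLike.congr_fun h a

lemma isCoaction_coact : IsCoaction (coact Z) where
  sum_coeff a := by
    have h := pull_act (toUnit Z ≫ η[Gm k]) (𝟙 Z)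
    rw [one_act, gmUnit_one, pull_id] at h
    have h' := DFunLike.congr_fun h a
    rw [AlgHom.comp_apply, laurentEval_eq_sum] at h'
    simpa using h'.symm
  coeff_homogeneous a n := by
    let κ : (Fn Z)[T;T⁻¹] →ₐ[k] (Fn Z)[T;T⁻¹][T;T⁻¹] := IsScalarTower.toAlgHom k (Fn Z)[T;T⁻¹] (Fn Z)[T;T⁻¹][T;T⁻¹]
    let φ : Fn Z →ₐ[k] (Fn Z)[T;T⁻¹] := IsScalarTower.toAlgHom k (Fn Z) (Fn Z)[T;T⁻¹]
    have hκ (b : (Fn Z)[T;T⁻¹]) : κ b = AddMonoidAlgebra.single 0 b := rfl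
    have hφ (a : Fn Z) : φ a = AddMonoidAlgebra.single 0 a := rfl
    have h_id (f : (Fn Z)[T;T⁻¹]) : laurentEval φ (unitT (Fn Z)) f = f := by
      rw [laurentEval_eq_sum]
      conv_rhs => rw [← AddMonoidAlgebra.sum_coeff_single f]
      refine Finsupp.sum_congr fun n _ ↦ ?_
      rw [hφ, unitT_zpow, AddMonoidAlgebra.single_mul_single, zero_add, mul_one]
    -- Associativity is applied to two independent variables, the outer and the inner one. With `aₘ`
    -- the components of `a`, it reads `∑ aₘ (outer · inner)^m = ∑ coact(aₘ) outer^m`; comparing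
    -- coefficients of `outer^n` gives homogeneity.
    have h := laurentEval_mul_coact (κ.comp φ) (unitT (Fn Z)[T;T⁻¹]) (Units.map (κ : (Fn Z)[T;T⁻¹] →* (Fn Z)[T;T⁻¹][T;T⁻¹]) (unitT _)) a
    have h₁ : (laurentEval (κ.comp φ) (Units.map (κ : (Fn Z)[T;T⁻¹] →* (Fn Z)[T;T⁻¹][T;T⁻¹]) (unitT _))).comp (coact Z) =
        κ.comp (coact Z) := by
      ext b : 1
      rw [AlgHom.comp_apply, ← map_laurentEval, h_id]; rfl
    rw [h₁, laurentEval_eq_sum, laurentEval_eq_sum] at h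
    have h₂ (m : ℤ) (b : Fn Z) : (κ.comp φ) b *
        (((unitT (Fn Z)[T;T⁻¹] * Units.map (κ : (Fn Z)[T;T⁻¹] →* (Fn Z)[T;T⁻¹][T;T⁻¹]) (unitT (Fn Z))) ^ m : (Fn Z)[T;T⁻¹][T;T⁻¹]ˣ) : (Fn Z)[T;T⁻¹][T;T⁻¹]) =
          AddMonoidAlgebra.single m (AddMonoidAlgebra.single m b : (Fn Z)[T;T⁻¹]) := by
      rw [mul_zpow, ← map_zpow, Units.val_mul, unitT_zpow]
      change κ (φ b) * (_ * κ ((unitT (Fn Z) ^ m : (Fn Z)[T;T⁻¹]ˣ) : (Fn Z)[T;T⁻¹])) = _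
      rw [unitT_zpow, hκ, hκ, hφ]
      simp only [AddMonoidAlgebra.single_mul_single, zero_add, add_zero, mul_one, one_mul]
    have h₃ (m : ℤ) (b : Fn Z) : (κ.comp (coact Z)) b * ((unitT (Fn Z)[T;T⁻¹] ^ m : (Fn Z)[T;T⁻¹][T;T⁻¹]ˣ) : (Fn Z)[T;T⁻¹][T;T⁻¹]) =
        AddMonoidAlgebra.single m (coact Z b : (Fn Z)[T;T⁻¹]) := by
      rw [unitT_zpow]
      change κ (coact Z b) * _ = _
      rw [hκ]
      simp only [AddMonoidAlgebra.single_mul_single, zero_add, mul_one]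
    simp only [h₂, h₃, Finsupp.sum] at h
    have h₄ := congrArg (fun f : (Fn Z)[T;T⁻¹][T;T⁻¹] ↦ f.coeff n) h
    simp only [AddMonoidAlgebra.coeff_sum, Finsupp.finsetSum_apply, AddMonoidAlgebra.coeff_single,
      Finsupp.single_apply, Finset.sum_ite_eq', Finsupp.mem_support_iff] at h₄
    by_cases hn : (coact Z a).coeff n = 0
    · rw [hn, map_zero, AddMonoidAlgebra.single_zero]
    · rw [← ne_eq, ← Finsupp.mem_support_iff] at hn
      rw [if_pos hn, if_pos hn] at h₄
      exact h₄.symm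

end Action

end GmInterpolation

end

noncomputable section

namespace GmInterpolation

variable {k : Type u} [Field k]

/-! ### The hyperbola ring over the base field, evaluated on homogeneous elements. -/

section HypLift

variable {R E : Type u} [CommRing R] [CommRing E] [Algebra k R] [Algebra k E] {t : R}
  (s : R →ₐ[k] E) (x y : E)

variable (t) in
/-- The coordinate `τ₁` in the hyperbola ring. -/
def xHyp : hypRing t := ⟨hypX t, hypX_mem t⟩

variable (t) in
/-- The coordinate `τ₂` in the hyperbola ring. -/
def yHyp : hypRing t := ⟨hypY t, hypY_mem t⟩

variable (k t) in
/-- The constants in the hyperbola ring. -/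
def constHyp : R →ₐ[k] hypRing t where
  __ := algebraMap R (hypRing t)
  commutes' _ := rfl

variable (k t) in
lemma xHyp_mul_yHyp : xHyp t * yHyp t = constHyp k t t := Subtype.ext (hypX_mul_hypY t)

variable (k t) in
/-- The restriction of functions on the hyperbola to the chart `τ₁ ≠ 0`. -/
def hypRes₁ : hypRing t →ₐ[k] R[T;T⁻¹] := (AlgHom.fst k _ _).comp (hypVal k t)

variable (k t) in
/-- The restriction of functions on the hyperbola to the chart `τ₂ ≠ 0`. -/
def hypRes₂ : hypRing t →ₐ[k] R[T;T⁻¹] := (AlgHom.snd k _ _).comp (hypVal k t)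

lemma hypRes₁_xHyp : hypRes₁ k t (xHyp t) = LaurentPolynomial.T 1 := rfl

lemma hypRes₁_yHyp : hypRes₁ k t (yHyp t) =
    LaurentPolynomial.C t * LaurentPolynomial.T (-1) := rfl

lemma hypRes₁_constHyp (r : R) : hypRes₁ k t (constHyp k t r) = LaurentPolynomial.C r := rfl

lemma hypRes₂_xHyp : hypRes₂ k t (xHyp t) =
    LaurentPolynomial.C t * LaurentPolynomial.T 1 := rfl

lemma hypRes₂_yHyp : hypRes₂ k t (yHyp t) = LaurentPolynomial.T (-1) := rfl

lemma hypRes₂_constHyp (r : R) : hypRes₂ k t (constHyp k t r) = LaurentPolynomial.C r := rfl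

/-- The universal property of the hyperbola ring, over a base field. -/
def hypLiftAlg (hxy : x * y = s t) : hypRing t →ₐ[k] E :=
  letI := s.toRingHom.toAlgebra
  { (hypLift x y hxy).toRingHom with
    commutes' := fun r ↦ by
      refine ((hypLift x y hxy).commutes (algebraMap k R r)).trans ?_
      exact s.commutes r }

lemma hypLiftAlg_algebraMap (hxy : x * y = s t) (r : R) :
    hypLiftAlg s x y hxy (constHyp k t r) = s r :=
  letI := s.toRingHom.toAlgebra
  (hypLift x y hxy).commutes r

lemma hypLiftAlg_X (hxy : x * y = s t) : hypLiftAlg s x y hxy (xHyp t) = x :=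
  letI := s.toRingHom.toAlgebra
  hypLift_X x y hxy

lemma hypLiftAlg_Y (hxy : x * y = s t) : hypLiftAlg s x y hxy (yHyp t) = y :=
  letI := s.toRingHom.toAlgebra
  hypLift_Y x y hxy

variable {A : Type u} [CommRing A] [Algebra k A] {c : A →ₐ[k] A[T;T⁻¹]} {u v : A →ₐ[k] R}

lemma IsInterpolating.map_eq_pow_mul (h : IsInterpolating c t u v) {a : A} {n : ℕ}
    (ha : c a = AddMonoidAlgebra.single (n : ℤ) a) : v a = t ^ n * u a := by
  have := (h a n).1
  rwa [ha, AddMonoidAlgebra.coeff_single, Finsupp.single_eq_same] at this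

lemma IsInterpolating.map_eq_pow_mul' (h : IsInterpolating c t u v) {a : A} {n : ℕ}
    (ha : c a = AddMonoidAlgebra.single (-n : ℤ) a) : u a = t ^ n * v a := by
  have := (h a n).2
  rwa [ha, AddMonoidAlgebra.coeff_single, Finsupp.single_eq_same] at this

lemma hypLiftAlg_toHypRing (hxy : x * y = s t) (h : IsInterpolating c t u v) {a : A} {n : ℕ}
    (ha : c a = AddMonoidAlgebra.single (n : ℤ) a) :
    hypLiftAlg s x y hxy (h.toHypRing a) = s (u a) * x ^ n := by
  let := s.toRingHom.toAlgebra
  change hypPsi x y (h.toHypRing a).1 = _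
  rw [h.coe_toHypRing, ha, AddMonoidAlgebra.mapAlgHom_single, AddMonoidAlgebra.mapAlgHom_single,
    hypPsi_single]
  rw [if_pos (by omega), if_neg (by omega), add_zero, Algebra.smul_def]
  rfl

lemma hypLiftAlg_toHypRing' (hxy : x * y = s t) (h : IsInterpolating c t u v) {a : A} {n : ℕ}
    (ha : c a = AddMonoidAlgebra.single (-n : ℤ) a) :
    hypLiftAlg s x y hxy (h.toHypRing a) = s (v a) * y ^ n := by
  -- Degree 0 is read off the first component, hence in terms of `u`; there `u` and `v` agree.
  rcases Nat.eq_zero_or_pos n with rfl | hn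
  · rw [hypLiftAlg_toHypRing s x y hxy h (n := 0) (by simpa using ha),
      h.map_eq_pow_mul (n := 0) (by simpa using ha)]
    simp
  let := s.toRingHom.toAlgebra
  change hypPsi x y (h.toHypRing a).1 = _
  rw [h.coe_toHypRing, ha, AddMonoidAlgebra.mapAlgHom_single, AddMonoidAlgebra.mapAlgHom_single,
    hypPsi_single]
  rw [if_neg (by omega), if_pos (by omega), zero_add, Algebra.smul_def]
  simp only [neg_neg, Int.toNat_natCast]
  rfl

/-- Algebra homomorphisms agreeing on homogeneous elements are equal. -/
lemma IsCoaction.algHom_ext (hc : IsCoaction c) {F G : A →ₐ[k] E}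
    (h₁ : ∀ (a : A) (n : ℕ), c a = AddMonoidAlgebra.single (n : ℤ) a → F a = G a)
    (h₂ : ∀ (a : A) (n : ℕ), c a = AddMonoidAlgebra.single (-n : ℤ) a → F a = G a) : F = G := by
  ext a
  rw [hc.eq_sum a, map_sum, map_sum]
  refine Finset.sum_congr rfl fun n _ ↦ ?_
  have hn := hc.coeff_homogeneous a n
  obtain ⟨m, rfl | rfl⟩ := n.eq_nat_or_neg
  · exact h₁ _ _ hn
  · exact h₂ _ _ hn

end HypLift

/-! ### Coordinates, action and sections on `𝕏_S`. -/

section Family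

variable {S : Sch k} (t : S ⟶ A1 k)

/-- The coordinate of the affine line, on a scheme over it. -/
def tFn : Fn S := pull t (tCoord k)

lemma comp_eq_toA1 {T : Sch k} (g : T ⟶ S) : g ≫ t = toA1 (pull g (tFn t)) := by
  rw [tFn, ← pull_comp_apply]
  exact (toA1_pull (g ≫ t)).symm

/-- The coordinate `τ₁` on `𝕏_S`. -/
def xFn : Fn (XS t) := pull (XSfst t) (τ₁ k)

/-- The coordinate `τ₂` on `𝕏_S`. -/
def yFn : Fn (XS t) := pull (XSfst t) (τ₂ k)

lemma xFn_mul_yFn : xFn t * yFn t = pull (XSsnd t) (tFn t) := by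
  rw [xFn, yFn, ← map_mul, ← pull_hyp, tFn, ← pull_comp_apply, ← pull_comp_apply, XS_condition]

/-- The homomorphism from the hyperbola ring to the functions on `𝕏_S`. -/
def hypFn : hypRing (tFn t) →ₐ[k] Fn (XS t) :=
  hypLiftAlg (pull (XSsnd t)) (xFn t) (yFn t) (xFn_mul_yFn t)

lemma pull_hypAct_τ₁ : pull (hypAct k) (τ₁ k) =
    pull (fst (Gm k) (XX k)) (gmCoord k : Fn (Gm k)) * pull (snd (Gm k) (XX k)) (τ₁ k) :=
  pull_toXX_τ₁ _ _

lemma pull_hypAct_τ₂ : pull (hypAct k) (τ₂ k) =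
    pull (fst (Gm k) (XX k)) ((gmCoord k)⁻¹ : (Fn (Gm k))ˣ).1 *
      pull (snd (Gm k) (XX k)) (τ₂ k) :=
  pull_toXX_τ₂ _ _

lemma pull_act_xFn {T : Sch k} (l : T ⟶ Gm k) (g : T ⟶ XS t) :
    pull (lift l g ≫ XSAct t) (xFn t) = gmUnit l * pull g (xFn t) := by
  rw [xFn, ← pull_comp_apply, ← pull_comp_apply, Category.assoc, XSAct, XSlift_fst,
    lift_whiskerLeft_assoc, pull_comp_apply, pull_hypAct_τ₁, map_mul, ← pull_comp_apply,
    ← pull_comp_apply, lift_fst, lift_snd, coe_gmUnit]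

lemma pull_act_yFn {T : Sch k} (l : T ⟶ Gm k) (g : T ⟶ XS t) :
    pull (lift l g ≫ XSAct t) (yFn t) = ((gmUnit l)⁻¹ : (Fn T)ˣ) * pull g (yFn t) := by
  rw [yFn, ← pull_comp_apply, ← pull_comp_apply, Category.assoc, XSAct, XSlift_fst,
    lift_whiskerLeft_assoc, pull_comp_apply, pull_hypAct_τ₂, map_mul, ← pull_comp_apply,
    ← pull_comp_apply, lift_fst, lift_snd]
  rfl

lemma lift_act_snd {T : Sch k} (l : T ⟶ Gm k) (g : T ⟶ XS t) :
    lift l g ≫ XSAct t ≫ XSsnd t = g ≫ XSsnd t := by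
  rw [XSAct, XSlift_snd, lift_snd_assoc]

lemma XS_hom_ext' {T : Sch k} {t : S ⟶ A1 k} {f g : T ⟶ XS t}
    (hx : pull f (xFn t) = pull g (xFn t)) (hy : pull f (yFn t) = pull g (yFn t))
    (h : f ≫ XSsnd t = g ≫ XSsnd t) : f = g := by
  refine XS_hom_ext (XX_hom_ext ?_ ?_) h
  · rw [pull_comp_apply, pull_comp_apply]; exact hx
  · rw [pull_comp_apply, pull_comp_apply]; exact hy

/-- The morphism to `𝕏_S` with given coordinates and given component in `S`. -/
def toXS {T : Sch k} (x y : Fn T) (g : T ⟶ S) (h : x * y = pull g (tFn t)) : T ⟶ XS t :=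
  XSlift (toXX x y) g (by rw [toXX_hyp, h, comp_eq_toA1])

lemma pull_toXS_xFn {T : Sch k} (x y : Fn T) (g : T ⟶ S) (h : x * y = pull g (tFn t)) :
    pull (toXS t x y g h) (xFn t) = x := by
  rw [xFn, ← pull_comp_apply, toXS, XSlift_fst, pull_toXX_τ₁]

lemma pull_toXS_yFn {T : Sch k} (x y : Fn T) (g : T ⟶ S) (h : x * y = pull g (tFn t)) :
    pull (toXS t x y g h) (yFn t) = y := by
  rw [yFn, ← pull_comp_apply, toXS, XSlift_fst, pull_toXX_τ₂]

lemma toXS_snd {T : Sch k} (x y : Fn T) (g : T ⟶ S) (h : x * y = pull g (tFn t)) :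
    toXS t x y g h ≫ XSsnd t = g := XSlift_snd _ _ _

lemma pull_secS_snd {σ : A1 k ⟶ XX k} (hσ : σ ≫ hyp k = 𝟙 _) : secS hσ t ≫ XSsnd t = 𝟙 S :=
  XSlift_snd _ _ _

lemma lift_sec_act_snd {σ : A1 k ⟶ XX k} (hσ : σ ≫ hyp k = 𝟙 _) {T : Sch k} (l : T ⟶ Gm k)
    (g : T ⟶ S) : (lift l (g ≫ secS hσ t) ≫ XSAct t) ≫ XSsnd t = g := by
  rw [Category.assoc, lift_act_snd, Category.assoc, pull_secS_snd]
  exact Category.comp_id g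

lemma pull_sec₁_xFn : pull (secS sec₁_hyp t) (xFn t) = 1 := by
  rw [xFn, ← pull_comp_apply, secS, XSlift_fst, pull_comp_apply, sec₁, pull_toXX_τ₁, map_one]

lemma pull_sec₁_yFn : pull (secS sec₁_hyp t) (yFn t) = tFn t := by
  rw [yFn, ← pull_comp_apply, secS, XSlift_fst, pull_comp_apply, sec₁, pull_toXX_τ₂, tFn]

lemma pull_sec₂_xFn : pull (secS sec₂_hyp t) (xFn t) = tFn t := by
  rw [xFn, ← pull_comp_apply, secS, XSlift_fst, pull_comp_apply, sec₂, pull_toXX_τ₁, tFn]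

lemma pull_sec₂_yFn : pull (secS sec₂_hyp t) (yFn t) = 1 := by
  rw [yFn, ← pull_comp_apply, secS, XSlift_fst, pull_comp_apply, sec₂, pull_toXX_τ₂, map_one]

end Family

/-! ### From interpolating triples to equivariant maps. -/

section Interpolation

variable {Z : Sch k} [ModObj (Gm k) Z] [IsAffine Z.left] {S : Sch k} {t : S ⟶ A1 k}
  {u v : Fn Z →ₐ[k] Fn S}

/-- The morphism `𝕏_S ⟶ Z` defined by an interpolating triple. -/
def interpMap (h : IsInterpolating (coact Z) (tFn t) u v) : XS t ⟶ Z :=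
  ofFn ((hypFn t).comp h.toHypRing)

lemma pull_interpMap (h : IsInterpolating (coact Z) (tFn t) u v) {a : Fn Z} {n : ℕ}
    (ha : coact Z a = AddMonoidAlgebra.single (n : ℤ) a) :
    pull (interpMap h) a = pull (XSsnd t) (u a) * xFn t ^ n := by
  rw [interpMap, pull_ofFn]
  exact hypLiftAlg_toHypRing _ _ _ (xFn_mul_yFn t) h ha

lemma pull_interpMap' (h : IsInterpolating (coact Z) (tFn t) u v) {a : Fn Z} {n : ℕ}
    (ha : coact Z a = AddMonoidAlgebra.single (-n : ℤ) a) :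
    pull (interpMap h) a = pull (XSsnd t) (v a) * yFn t ^ n := by
  rw [interpMap, pull_ofFn]
  exact hypLiftAlg_toHypRing' _ _ _ (xFn_mul_yFn t) h ha

/-- An element `a` of degree `n` pulls back to `u(a) τ₁ⁿ` and one of degree `-n` to `v(a) τ₂ⁿ`,
while `τ₁` and `τ₂` scale by `λ` and `λ⁻¹`. -/
lemma interpMap_equivariant (h : IsInterpolating (coact Z) (tFn t) u v) :
    XSAct t ≫ interpMap h = (Gm k ◁ interpMap h) ≫ γ[Gm k, Z] := by
  have h₁ : XSAct t = lift (fst (Gm k) (XS t)) (snd (Gm k) (XS t)) ≫ XSAct t := by simp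
  have h₂ : Gm k ◁ interpMap h =
      lift (fst (Gm k) (XS t)) (snd (Gm k) (XS t) ≫ interpMap h) := by
    ext1 <;> simp
  have h₃ : XSAct t ≫ XSsnd t = snd (Gm k) (XS t) ≫ XSsnd t := XSlift_snd _ _ _
  have hx := pull_act_xFn t (fst (Gm k) (XS t)) (snd (Gm k) (XS t))
  have hy := pull_act_yFn t (fst (Gm k) (XS t)) (snd (Gm k) (XS t))
  rw [← h₁] at hx hy
  rw [h₂]
  apply hom_ext_of_pull
  rw [pull_act]
  refine isCoaction_coact.algHom_ext (fun a n ha ↦ ?_) fun a n ha ↦ ?_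
  · rw [AlgHom.comp_apply, ha, laurentEval_single, pull_comp_apply, pull_comp_apply,
      pull_interpMap h ha, map_mul, map_mul, map_pow, map_pow, hx, ← pull_comp_apply, h₃,
      ← pull_comp_apply, zpow_natCast, Units.val_pow_eq_pow_val]
    ring
  · rw [AlgHom.comp_apply, ha, laurentEval_single, pull_comp_apply, pull_comp_apply,
      pull_interpMap' h ha, map_mul, map_mul, map_pow, map_pow, hy, ← pull_comp_apply, h₃,
      ← pull_comp_apply, zpow_neg, zpow_natCast, ← inv_pow, Units.val_pow_eq_pow_val]
    ring

/-- At `(τ₁, τ₂) = (1, t)` the two formulas become `u(a)` and `v(a) tⁿ`, and the latter is `u(a)` by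
the interpolation equations. -/
lemma pull_sec₁_interpMap (h : IsInterpolating (coact Z) (tFn t) u v) :
    pull (secS sec₁_hyp t ≫ interpMap h) = u := by
  refine isCoaction_coact.algHom_ext (fun a n ha ↦ ?_) fun a n ha ↦ ?_
  · rw [pull_comp_apply, pull_interpMap h ha, map_mul, map_pow, pull_sec₁_xFn, ← pull_comp_apply,
      pull_secS_snd, pull_id, one_pow, mul_one]
    rfl
  · rw [pull_comp_apply, pull_interpMap' h ha, map_mul, map_pow, pull_sec₁_yFn, ← pull_comp_apply,
      pull_secS_snd, pull_id, h.map_eq_pow_mul' ha, mul_comm]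
    rfl

lemma pull_sec₂_interpMap (h : IsInterpolating (coact Z) (tFn t) u v) :
    pull (secS sec₂_hyp t ≫ interpMap h) = v := by
  refine isCoaction_coact.algHom_ext (fun a n ha ↦ ?_) fun a n ha ↦ ?_
  · rw [pull_comp_apply, pull_interpMap h ha, map_mul, map_pow, pull_sec₂_xFn, ← pull_comp_apply,
      pull_secS_snd, pull_id, h.map_eq_pow_mul ha, mul_comm]
    rfl
  · rw [pull_comp_apply, pull_interpMap' h ha, map_mul, map_pow, pull_sec₂_yFn, ← pull_comp_apply,
      pull_secS_snd, pull_id, one_pow, mul_one]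
    rfl

/-- The point of `Z̃` defined by an interpolating triple. -/
def interpPoint (h : IsInterpolating (coact Z) (tFn t) u v) : TildePoint Z S where
  t := t
  f := interpMap h
  equivariant := interpMap_equivariant h

end Interpolation

/-! ### The spectrum of the hyperbola ring and its two charts. -/

section AffineBase

variable {S : Sch k} [IsAffine S.left] (t : S ⟶ A1 k)

section

variable {B : Type u} [CommRing B] [Algebra k B] (φ : Fn S →ₐ[k] B) (x y : B)
  (h : x * y = φ (tFn t))

/-- The morphism to `𝕏_S` from the spectrum of an algebra, for affine `S`. -/
def specToXS : SpecO k B ⟶ XS t :=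
  toXS t ((specFn k B).symm x) ((specFn k B).symm y) (ofFn ((specFn k B).symm.toAlgHom.comp φ))
    (by rw [pull_ofFn, ← map_mul, h]; rfl)

lemma pull_specToXS_xFn : pull (specToXS t φ x y h) (xFn t) = (specFn k B).symm x :=
  pull_toXS_xFn _ _ _ _ _

lemma pull_specToXS_yFn : pull (specToXS t φ x y h) (yFn t) = (specFn k B).symm y :=
  pull_toXS_yFn _ _ _ _ _

lemma pull_specToXS_snd (r : Fn S) : pull (specToXS t φ x y h ≫ XSsnd t) r =
    (specFn k B).symm (φ r) := by
  rw [specToXS, toXS_snd, pull_ofFn]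
  rfl

end

/-- The morphism from the spectrum of the hyperbola ring to `𝕏_S`, for affine `S`. -/
def ofHypSpec : SpecO k (hypRing (tFn t)) ⟶ XS t :=
  specToXS t (constHyp k (tFn t)) (xHyp (tFn t)) (yHyp (tFn t)) (xHyp_mul_yHyp k (tFn t))

lemma pull_ofHypSpec_xFn : pull (ofHypSpec t) (xFn t) =
    (specFn k (hypRing (tFn t))).symm (xHyp (tFn t)) := pull_specToXS_xFn _ _ _ _ _

lemma pull_ofHypSpec_yFn : pull (ofHypSpec t) (yFn t) =
    (specFn k (hypRing (tFn t))).symm (yHyp (tFn t)) := pull_specToXS_yFn _ _ _ _ _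

lemma pull_ofHypSpec_snd (r : Fn S) : pull (ofHypSpec t ≫ XSsnd t) r =
    (specFn k (hypRing (tFn t))).symm (constHyp k (tFn t) r) := pull_specToXS_snd _ _ _ _ _ r

/-- Thus `ofHypSpec t` is a split epimorphism, and morphisms out of `𝕏_S` are determined by
homomorphisms into the hyperbola ring. -/
lemma toSpecO_ofHypSpec : toSpecO (hypFn t) ≫ ofHypSpec t = 𝟙 _ := by
  apply XS_hom_ext'
  · rw [pull_comp_apply, pull_ofHypSpec_xFn, pull_toSpecO, pull_id]
    exact hypLiftAlg_X _ _ _ (xFn_mul_yFn t)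
  · rw [pull_comp_apply, pull_ofHypSpec_yFn, pull_toSpecO, pull_id]
    exact hypLiftAlg_Y _ _ _ (xFn_mul_yFn t)
  · apply hom_ext_of_pull
    ext r
    rw [Category.assoc, pull_comp_apply, pull_ofHypSpec_snd, pull_toSpecO, Category.id_comp]
    exact hypLiftAlg_algebraMap _ _ _ (xFn_mul_yFn t) r

/-- The morphism from the first chart to the spectrum of the hyperbola ring. -/
def chart₁ {S : Sch k} (t : S ⟶ A1 k) : SpecO k (Fn S)[T;T⁻¹] ⟶ SpecO k (hypRing (tFn t)) :=
  toSpecO ((specFn k (Fn S)[T;T⁻¹]).symm.toAlgHom.comp (hypRes₁ k (tFn t)))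

/-- The morphism from the second chart to the spectrum of the hyperbola ring. -/
def chart₂ {S : Sch k} (t : S ⟶ A1 k) : SpecO k (Fn S)[T;T⁻¹] ⟶ SpecO k (hypRing (tFn t)) :=
  toSpecO ((specFn k (Fn S)[T;T⁻¹]).symm.toAlgHom.comp (hypRes₂ k (tFn t)))

lemma pull_chart₁ {S : Sch k} (t : S ⟶ A1 k) (b : hypRing (tFn t)) :
    pull (chart₁ t) ((specFn k (hypRing (tFn t))).symm b) =
      (specFn k (Fn S)[T;T⁻¹]).symm (hypRes₁ k (tFn t) b) := pull_toSpecO _ _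

lemma pull_chart₂ {S : Sch k} (t : S ⟶ A1 k) (b : hypRing (tFn t)) :
    pull (chart₂ t) ((specFn k (hypRing (tFn t))).symm b) =
      (specFn k (Fn S)[T;T⁻¹]).symm (hypRes₂ k (tFn t) b) := pull_toSpecO _ _

lemma gmUnit_univGm (S : Sch k) : (gmUnit (univGm S) : Fn (SpecO k (Fn S)[T;T⁻¹])) =
    (specFn k (Fn S)[T;T⁻¹]).symm (LaurentPolynomial.T 1) := by
  rw [univGm, gmUnit_toGm]; rfl

lemma gmUnit_univGm_inv (S : Sch k) :
    (((gmUnit (univGm S))⁻¹ : (Fn (SpecO k (Fn S)[T;T⁻¹]))ˣ) : Fn (SpecO k (Fn S)[T;T⁻¹])) =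
      (specFn k (Fn S)[T;T⁻¹]).symm (LaurentPolynomial.T (-1)) := by
  rw [univGm, gmUnit_toGm]; rfl

lemma pull_univPt (r : Fn S) : pull (univPt S) r =
    (specFn k (Fn S)[T;T⁻¹]).symm (LaurentPolynomial.C r) := by
  rw [univPt, pull_ofFn]; rfl

/-- The first chart is the orbit of the section `(1, t)`, by `λ · (1, t) = (λ, λ⁻¹ t)`. Equivariance
then determines a map on this chart by its value on the section. -/
lemma chart₁_ofHypSpec : chart₁ t ≫ ofHypSpec t =
    lift (univGm S) (univPt S ≫ secS sec₁_hyp t) ≫ XSAct t := by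
  apply XS_hom_ext'
  · rw [pull_comp_apply, pull_ofHypSpec_xFn, pull_chart₁, pull_act_xFn, pull_comp_apply,
      pull_sec₁_xFn, map_one, mul_one, gmUnit_univGm, hypRes₁_xHyp]
  · rw [pull_comp_apply, pull_ofHypSpec_yFn, pull_chart₁, pull_act_yFn, pull_comp_apply,
      pull_sec₁_yFn, pull_univPt, gmUnit_univGm_inv, hypRes₁_yHyp, mul_comm, map_mul]
  · apply hom_ext_of_pull
    ext r
    rw [Category.assoc, pull_comp_apply, pull_ofHypSpec_snd]
    refine (pull_chart₁ t (constHyp k (tFn t) r)).trans ?_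
    rw [lift_sec_act_snd, pull_univPt, hypRes₁_constHyp]

lemma chart₂_ofHypSpec : chart₂ t ≫ ofHypSpec t =
    lift (univGm S) (univPt S ≫ secS sec₂_hyp t) ≫ XSAct t := by
  apply XS_hom_ext'
  · rw [pull_comp_apply, pull_ofHypSpec_xFn, pull_chart₂, pull_act_xFn, pull_comp_apply,
      pull_sec₂_xFn, pull_univPt, gmUnit_univGm, hypRes₂_xHyp, mul_comm, map_mul]
  · rw [pull_comp_apply, pull_ofHypSpec_yFn, pull_chart₂, pull_act_yFn, pull_comp_apply,
      pull_sec₂_yFn, map_one, mul_one, gmUnit_univGm_inv, hypRes₂_yHyp]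
  · apply hom_ext_of_pull
    ext r
    rw [Category.assoc, pull_comp_apply, pull_ofHypSpec_snd]
    refine (pull_chart₂ t (constHyp k (tFn t) r)).trans ?_
    rw [lift_sec_act_snd, pull_univPt, hypRes₂_constHyp]

end AffineBase

end GmInterpolation

end

noncomputable section

namespace GmInterpolation

variable {k : Type u} [Field k]

/-! ### Equivariant maps over an affine base yield interpolating triples. -/

section AffinePoints

lemma laurentEval_unitT {A R : Type u} [CommRing A] [CommRing R] [Algebra k A] [Algebra k R]
    (u : A →ₐ[k] R) (f : A[T;T⁻¹]) :
    laurentEval ((IsScalarTower.toAlgHom k R R[T;T⁻¹]).comp u) (unitT R) f =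
      AddMonoidAlgebra.mapAlgHom ℤ u f := by
  rw [laurentEval_eq_sum]
  conv_rhs => rw [← AddMonoidAlgebra.sum_coeff_single f, Finsupp.sum, map_sum]
  rw [Finsupp.sum]
  refine Finset.sum_congr rfl fun n _ ↦ ?_
  rw [unitT_zpow, AddMonoidAlgebra.mapAlgHom_single]
  change AddMonoidAlgebra.single 0 (u _) * _ = _
  rw [AddMonoidAlgebra.single_mul_single, zero_add, mul_one]

/-- The homomorphism to the hyperbola ring given by a morphism `𝕏_S ⟶ Z`, for affine `S`. -/
def hypOf {Z S : Sch k} [IsAffine S.left] {t : S ⟶ A1 k} (f : XS t ⟶ Z) : Fn Z →ₐ[k] hypRing (tFn t) :=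
  (specFn k (hypRing (tFn t))).toAlgHom.comp (pull (ofHypSpec t ≫ f))

lemma symm_hypOf {Z S : Sch k} [IsAffine S.left] {t : S ⟶ A1 k} (f : XS t ⟶ Z) (a : Fn Z) :
    (specFn k (hypRing (tFn t))).symm (hypOf f a) = pull (ofHypSpec t ≫ f) a :=
  (specFn k (hypRing (tFn t))).symm_apply_apply _

variable {Z : Sch k} [ModObj (Gm k) Z] {S : Sch k}

lemma lift_act_of_equivariant {t : S ⟶ A1 k} {f : XS t ⟶ Z}
    (hf : XSAct t ≫ f = (Gm k ◁ f) ≫ γ[Gm k, Z]) {T : Sch k} (l : T ⟶ Gm k) (g : T ⟶ XS t) :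
    (lift l g ≫ XSAct t) ≫ f = lift l (g ≫ f) ≫ γ[Gm k, Z] := by
  rw [Category.assoc, hf, lift_whiskerLeft_assoc]

variable [IsAffine Z.left]

lemma pull_lift_univ [IsAffine S.left] (z : S ⟶ Z) (a : Fn Z) :
    pull (lift (univGm S) (univPt S ≫ z) ≫ γ[Gm k, Z]) a =
      (specFn k (Fn S)[T;T⁻¹]).symm (AddMonoidAlgebra.mapAlgHom ℤ (pull z) (coact Z a)) := by
  rw [pull_act, AlgHom.comp_apply, ← laurentEval_unitT]
  refine Eq.trans ?_
    (map_laurentEval (specFn k (Fn S)[T;T⁻¹]).symm.toAlgHom _ _ (coact Z a)).symm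
  have h₁ : gmUnit (univGm S) = Units.map
      ((specFn k (Fn S)[T;T⁻¹]).symm : _ →* Fn (SpecO k (Fn S)[T;T⁻¹])) (unitT (Fn S)) := by
    rw [univGm, gmUnit_toGm]
  have h₂ : pull (univPt S ≫ z) = (specFn k (Fn S)[T;T⁻¹]).symm.toAlgHom.comp
      ((IsScalarTower.toAlgHom k (Fn S) (Fn S)[T;T⁻¹]).comp (pull z)) := by
    rw [pull_comp, univPt, pull_ofFn]
    rfl
  rw [h₁, h₂]
  rfl

variable [IsAffine S.left] {t : S ⟶ A1 k}

lemma hypRes₁_hypOf {f : XS t ⟶ Z} (hf : XSAct t ≫ f = (Gm k ◁ f) ≫ γ[Gm k, Z]) (a : Fn Z) :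
    hypRes₁ k (tFn t) (hypOf f a) =
      AddMonoidAlgebra.mapAlgHom ℤ (pull (secS sec₁_hyp t ≫ f)) (coact Z a) := by
  apply (specFn k (Fn S)[T;T⁻¹]).symm.injective
  rw [← pull_lift_univ, ← pull_chart₁, symm_hypOf, ← pull_comp_apply, ← Category.assoc,
    chart₁_ofHypSpec, lift_act_of_equivariant hf, Category.assoc]

lemma hypRes₂_hypOf {f : XS t ⟶ Z} (hf : XSAct t ≫ f = (Gm k ◁ f) ≫ γ[Gm k, Z]) (a : Fn Z) :
    hypRes₂ k (tFn t) (hypOf f a) =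
      AddMonoidAlgebra.mapAlgHom ℤ (pull (secS sec₂_hyp t ≫ f)) (coact Z a) := by
  apply (specFn k (Fn S)[T;T⁻¹]).symm.injective
  rw [← pull_lift_univ, ← pull_chart₂, symm_hypOf, ← pull_comp_apply, ← Category.assoc,
    chart₂_ofHypSpec, lift_act_of_equivariant hf, Category.assoc]

/-- The restrictions of `f` to the charts are orbit maps, with coefficients `u` and `v` of the
homogeneous components of `a`. They come from one element of the hyperbola ring, so they are
compatible. -/
lemma isInterpolating_of_isAffine {f : XS t ⟶ Z} (hf : XSAct t ≫ f = (Gm k ◁ f) ≫ γ[Gm k, Z]) :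
    IsInterpolating (coact Z) (tFn t) (pull (secS sec₁_hyp t ≫ f))
      (pull (secS sec₂_hyp t ≫ f)) := by
  intro a n
  have h := (mem_hypRing_iff (tFn t)).1 (hypOf f a).2 n
  have h₁ : (hypOf f a).1.1 = _ := hypRes₁_hypOf hf a
  have h₂ : (hypOf f a).1.2 = _ := hypRes₂_hypOf hf a
  rw [h₁, h₂] at h
  simpa using h

lemma eq_of_pull_sec_of_isAffine {f f' : XS t ⟶ Z} (hf : XSAct t ≫ f = (Gm k ◁ f) ≫ γ[Gm k, Z])
    (hf' : XSAct t ≫ f' = (Gm k ◁ f') ≫ γ[Gm k, Z])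
    (h₁ : secS sec₁_hyp t ≫ f = secS sec₁_hyp t ≫ f')
    (h₂ : secS sec₂_hyp t ≫ f = secS sec₂_hyp t ≫ f') : f = f' := by
  have h : ofHypSpec t ≫ f = ofHypSpec t ≫ f' := by
    apply hom_ext_of_pull
    ext a
    rw [← symm_hypOf, ← symm_hypOf]
    congr 1
    apply Subtype.ext
    apply Prod.ext
    · change hypRes₁ k (tFn t) (hypOf f a) = hypRes₁ k (tFn t) (hypOf f' a)
      rw [hypRes₁_hypOf hf, hypRes₁_hypOf hf', h₁]
    · change hypRes₂ k (tFn t) (hypOf f a) = hypRes₂ k (tFn t) (hypOf f' a)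
      rw [hypRes₂_hypOf hf, hypRes₂_hypOf hf', h₂]
  have h' := congrArg (fun g ↦ toSpecO (hypFn t) ≫ g) h
  simp only [← Category.assoc, toSpecO_ofHypSpec] at h'
  exact (Category.id_comp f).symm.trans (h'.trans (Category.id_comp f'))

end AffinePoints

/-! ### Reduction from arbitrary to affine bases. -/

section Points

lemma hom_ext_of_forall_isAffine {S X : Sch k} {f g : S ⟶ X}
    (h : ∀ (T : Sch k) (_ : IsAffine T.left) (j : T ⟶ S), j ≫ f = j ≫ g) : f = g := by
  ext1
  refine Scheme.Cover.hom_ext S.left.affineCover _ _ fun i ↦ ?_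
  exact congrArg (fun j ↦ j.left) (h (Over.mk (S.left.affineCover.f i ≫ S.hom))
    (inferInstanceAs (IsAffine (S.left.affineCover.X i))) (Over.homMk (S.left.affineCover.f i) rfl))

lemma fn_ext_of_forall_isAffine {S : Sch k} {a b : Fn S}
    (h : ∀ (T : Sch k) (_ : IsAffine T.left) (j : T ⟶ S), pull j a = pull j b) : a = b := by
  have : toA1 a = toA1 b := hom_ext_of_forall_isAffine fun T hT j ↦ by
    rw [comp_toA1, comp_toA1]
    exact congrArg toA1 (h T hT j)
  rw [← pull_toA1 a, this, pull_toA1]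

variable {Z : Sch k} [ModObj (Gm k) Z] {S : Sch k}

lemma TildePoint.pull_sec_comap {T : Sch k} (p : TildePoint Z S) (j : T ⟶ S) {σ : A1 k ⟶ XX k}
    (hσ : σ ≫ hyp k = 𝟙 _) :
    secS hσ (p.comap j).t ≫ (p.comap j).f = j ≫ secS hσ p.t ≫ p.f := by
  change secS hσ (j ≫ p.t) ≫ XSMap j rfl ≫ p.f = _
  rw [← Category.assoc, secS_XSMap, Category.assoc]

variable [IsAffine Z.left]

lemma TildePoint.isInterpolating (p : TildePoint Z S) :
    IsInterpolating (coact Z) (tFn p.t) (pull (secS sec₁_hyp p.t ≫ p.f))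
      (pull (secS sec₂_hyp p.t ≫ p.f)) := by
  have key (T : Sch k) (_ : IsAffine T.left) (j : T ⟶ S) : IsInterpolating (coact Z)
      (pull j (tFn p.t)) ((pull j).comp (pull (secS sec₁_hyp p.t ≫ p.f)))
      ((pull j).comp (pull (secS sec₂_hyp p.t ≫ p.f))) := by
    have := isInterpolating_of_isAffine (p.comap j).equivariant
    rw [p.pull_sec_comap, p.pull_sec_comap, pull_comp _ j, pull_comp _ j] at this
    convert this using 1
    exact (pull_comp_apply p.t j _).symm
  intro a n
  constructor <;> refine fn_ext_of_forall_isAffine fun T hT j ↦ ?_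
  · rw [map_mul, map_pow]
    exact (key T hT j a n).1
  · rw [map_mul, map_pow]
    exact (key T hT j a n).2

lemma TildePoint.ext_of_sec {p q : TildePoint Z S} (ht : p.t = q.t)
    (h₁ : secS sec₁_hyp p.t ≫ p.f = secS sec₁_hyp q.t ≫ q.f)
    (h₂ : secS sec₂_hyp p.t ≫ p.f = secS sec₂_hyp q.t ≫ q.f) : p = q := by
  obtain ⟨t, f, hf⟩ := p
  obtain ⟨t', f', hf'⟩ := q
  obtain rfl : t = t' := ht
  suffices f = f' by subst this; rfl
  refine hom_ext_of_forall_isAffine fun T hT j ↦ ?_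
  let P : TildePoint Z S := ⟨t, f, hf⟩
  let Q : TildePoint Z S := ⟨t, f', hf'⟩
  have h : XSMap (j ≫ XSsnd t) (rfl : _ = (j ≫ XSsnd t) ≫ t) ≫ f = XSMap (j ≫ XSsnd t) rfl ≫ f' := by
    refine eq_of_pull_sec_of_isAffine (P.comap (j ≫ XSsnd t)).equivariant
      (Q.comap (j ≫ XSsnd t)).equivariant ?_ ?_
    · exact (P.pull_sec_comap _ sec₁_hyp).trans
        ((congrArg (fun g ↦ (j ≫ XSsnd t) ≫ g) h₁).trans (Q.pull_sec_comap _ sec₁_hyp).symm)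
    · exact (P.pull_sec_comap _ sec₂_hyp).trans
        ((congrArg (fun g ↦ (j ≫ XSsnd t) ≫ g) h₂).trans (Q.pull_sec_comap _ sec₂_hyp).symm)
  -- An affine test object `T` over `𝕏_S` factors through `𝕏_T`, where the uniqueness over the
  -- affine base `T` applies.
  obtain ⟨r, hr⟩ : ∃ r, j = r ≫ XSMap (j ≫ XSsnd t) (rfl : _ = (j ≫ XSsnd t) ≫ t) := by
    refine ⟨XSlift (j ≫ XSfst t) (𝟙 T)
      (by rw [Category.id_comp, Category.assoc, Category.assoc, XS_condition]), ?_⟩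
    apply XS_hom_ext
    · rw [Category.assoc, XSMap, XSlift_fst, XSlift_fst]
    · rw [Category.assoc, XSMap, XSlift_snd, ← Category.assoc, XSlift_snd, Category.id_comp]
  have hr' (g : XS t ⟶ Z) : j ≫ g = r ≫ XSMap (j ≫ XSsnd t) rfl ≫ g :=
    (congrArg (fun j' ↦ j' ≫ g) hr).trans (Category.assoc _ _ _)
  rw [hr' f, hr' f', h]

end Points

end GmInterpolation

end

noncomputable section

namespace GmInterpolation

variable {k : Type u} [Field k]

/-! ### Functions on `𝔸¹ × Z × Z`. -/

section Ambient

instance : IsAffine (A1 k).left :=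
  inferInstanceAs (IsAffine 𝔸(PUnit.{u + 1}; Spec (CommRingCat.of k)))

instance isAffine_tensor_left (X Y : Sch k) [IsAffine X.left] [IsAffine Y.left] :
    IsAffine (X ⊗ Y).left :=
  inferInstanceAs (IsAffine (pullback X.hom Y.hom))

lemma smooth_fn (Z : Sch k) [IsAffine Z.left] (h : Smooth Z.hom) : Algebra.Smooth k (Fn Z) := by
  have h₁ := HasRingHomProperty.appTop (P := @Smooth) Z.hom h
  have h₂ : (Scheme.ΓSpecIso (CommRingCat.of k)).inv.hom.Smooth := .of_bijective
    (Scheme.ΓSpecIso (CommRingCat.of k)).symm.commRingCatIsoToRingEquiv.bijective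
  exact h₂.comp h₁

variable {Z : Sch k} {T : Sch k}

/-- The homomorphism from the ambient ring given by a morphism to `𝔸¹ × Z × Z`. -/
def ambientPull (g : T ⟶ A1 k ⊗ Z ⊗ Z) : AmbientRing (Fn Z) k →ₐ[k] Fn T :=
  ambientEval (tFn (g ≫ fst _ _)) (pull (g ≫ snd _ _ ≫ fst _ _)) (pull (g ≫ snd _ _ ≫ snd _ _))

lemma pull_ambientPull {T' : Sch k} (g : T ⟶ A1 k ⊗ Z ⊗ Z) (j : T' ⟶ T)
    (x : AmbientRing (Fn Z) k) : pull j (ambientPull g x) = ambientPull (j ≫ g) x := by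
  have : (pull j).comp (ambientPull g) = ambientPull (j ≫ g) := by
    refine ambient_hom_ext ?_ (fun a ↦ ?_) fun a ↦ ?_
    · rw [AlgHom.comp_apply, ambientPull, ambientPull, ambientEval_X, ambientEval_X, tFn, tFn,
        ← pull_comp_apply, Category.assoc]
    · rw [AlgHom.comp_apply, ambientPull, ambientPull, ambientEval_left, ambientEval_left,
        ← pull_comp_apply, Category.assoc]
    · rw [AlgHom.comp_apply, ambientPull, ambientPull, ambientEval_right, ambientEval_right,
        ← pull_comp_apply, Category.assoc]
  exact DFunLike.congr_fun this x

lemma A1_hom_ext {f g : T ⟶ A1 k} (h : tFn f = tFn g) : f = g := by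
  rw [← toA1_pull f, ← toA1_pull g]
  exact congrArg toA1 h

variable [IsAffine Z.left]

variable (Z) in
-- The product is a retract of the spectrum of the ambient ring, since `r ≫ s` has the right
-- coordinates; hence each of its functions is pulled back along `r`.
lemma ambientPull_id_surjective : Function.Surjective (ambientPull (𝟙 (A1 k ⊗ Z ⊗ Z))) := by
  let σ := (specFn k (AmbientRing (Fn Z) k)).symm
  let r := toSpecO (ambientPull (𝟙 (A1 k ⊗ Z ⊗ Z)))
  let s : SpecO k (AmbientRing (Fn Z) k) ⟶ A1 k ⊗ Z ⊗ Z :=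
    lift (toA1 (σ Polynomial.X))
      (lift (ofFn (σ.toAlgHom.comp ambientLeft)) (ofFn (σ.toAlgHom.comp ambientRight)))
  have hr (x : AmbientRing (Fn Z) k) : pull r (σ x) = ambientPull (𝟙 _) x := pull_toSpecO _ _
  have hrs : r ≫ s = 𝟙 _ := by
    refine CartesianMonoidalCategory.hom_ext _ _ (A1_hom_ext ?_)
      (CartesianMonoidalCategory.hom_ext _ _ (hom_ext_of_pull ?_) (hom_ext_of_pull ?_))
    · rw [Category.assoc, lift_fst, tFn, pull_comp_apply]
      erw [pull_toA1]
      rw [hr, ambientPull, ambientEval_X]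
    · ext a
      rw [Category.assoc, Category.assoc, lift_snd_assoc, lift_fst, pull_comp_apply, pull_ofFn]
      refine (hr _).trans ?_
      refine (ambientEval_left _ _ _ a).trans ?_
      rw [Category.assoc]
    · ext a
      rw [Category.assoc, Category.assoc, lift_snd_assoc, lift_snd, pull_comp_apply, pull_ofFn]
      refine (hr _).trans ?_
      refine (ambientEval_right _ _ _ a).trans ?_
      rw [Category.assoc]
  intro x
  refine ⟨σ.symm (pull s x), ?_⟩
  rw [← hr, AlgEquiv.apply_symm_apply, ← pull_comp_apply, hrs, pull_id]
  rfl

end Ambient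

/-! ### The graph of the action and its closure. -/

section Graph

variable {Z : Sch k} [ModObj (Gm k) Z] {T : Sch k}

lemma lift_graphToA1 (l : T ⟶ Gm k) (z : T ⟶ Z) : lift l z ≫ graphToA1 Z =
    lift (l ≫ gmToA1 k) (lift z (lift l z ≫ γ[Gm k, Z])) := by
  simp [graphToA1, graph, comp_lift_assoc]

lemma graphToA1_eq : graphToA1 Z =
    lift (fst (Gm k) Z ≫ gmToA1 k) (lift (snd (Gm k) Z) γ[Gm k, Z]) := by
  have := lift_graphToA1 (fst (Gm k) Z) (snd (Gm k) Z)
  rwa [lift_fst_snd, Category.id_comp, Category.id_comp] at this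

lemma tFn_comp_gmToA1 (l : T ⟶ Gm k) : tFn (l ≫ gmToA1 k) = gmUnit l := by
  rw [tFn, pull_comp_apply, gmToA1, pull_toA1]
  rfl

variable (Z) in
/-- The graph of the action, as a subscheme of its closure. -/
def graphToClosure : Gm k ⊗ Z ⟶ graphClosure Z :=
  Over.homMk (graphToA1 Z).left.toImage (by
    refine ((graphToA1 Z).left.toImage_imageι_assoc _).trans ?_
    exact Over.w _)

variable (Z) in
lemma graphToClosure_graphClosureι : graphToClosure Z ≫ graphClosureι Z = graphToA1 Z := by
  apply Over.OverMorphism.ext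
  exact (graphToA1 Z).left.toImage_imageι

instance : IsClosedImmersion (graphClosureι Z).left :=
  inferInstanceAs (IsClosedImmersion (graphToA1 Z).left.imageι)

instance : Mono (graphClosureι Z) := Over.mono_of_mono_left _

variable [IsAffine Z.left]

instance : IsAffine (graphClosure Z).left :=
  (IsClosedImmersion.isAffine_surjective_of_isAffine (graphClosureι Z).left).1

lemma pull_graphClosureι_surjective : Function.Surjective (pull (graphClosureι Z)) :=
  (IsClosedImmersion.isAffine_surjective_of_isAffine (graphClosureι Z).left).2

lemma pull_graphToClosure_injective : Function.Injective (pull (graphToClosure Z)) :=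
  (graphToA1 Z).left.toImage_app_injective ⟨⊤, isAffineOpen_top _⟩

lemma isInterpolating_graph (l : T ⟶ Gm k) (z : T ⟶ Z) : IsInterpolating (coact Z)
    (gmUnit l : Fn T) (pull z) (pull (lift l z ≫ γ[Gm k, Z])) := by
  have h := isCoaction_coact (Z := Z).isInterpolating.comp (laurentEval (pull z) (gmUnit l))
  rw [pull_act]
  convert h using 1
  · have := laurentEval_single (pull z) (gmUnit l) 1 1
    rw [map_one, one_mul, zpow_one] at this
    exact this.symm
  · ext a
    have := laurentEval_single (pull z) (gmUnit l) 0 a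
    rw [zpow_zero, Units.val_one, mul_one] at this
    exact this.symm

variable (Z) in
-- The equations hold on the graph, and restriction of functions from the closure to the graph is
-- injective.
lemma isInterpolating_graphClosureι : IsInterpolating (coact Z)
    (tFn (graphClosureι Z ≫ fst _ _)) (pull (graphClosureι Z ≫ snd _ _ ≫ fst _ _))
    (pull (graphClosureι Z ≫ snd _ _ ≫ snd _ _)) := by
  refine IsInterpolating.of_injective (π := pull (graphToClosure Z))
    pull_graphToClosure_injective ?_
  have h := isInterpolating_graph (fst (Gm k) Z) (snd (Gm k) Z)
  rw [lift_fst_snd, Category.id_comp] at h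
  convert h using 1
  · rw [tFn, ← pull_comp_apply, ← Category.assoc, graphToClosure_graphClosureι, graphToA1_eq,
      lift_fst]
    exact tFn_comp_gmToA1 _
  · rw [← pull_comp, ← Category.assoc, graphToClosure_graphClosureι, graphToA1_eq, lift_snd_assoc,
      lift_fst]
  · rw [← pull_comp, ← Category.assoc, graphToClosure_graphClosureι, graphToA1_eq, lift_snd_assoc,
      lift_snd]

variable (Z) in
/-- The tautological point of `Z̃` over the closure of the graph. -/
def closurePoint : TildePoint Z (graphClosure Z) := interpPoint (isInterpolating_graphClosureι Z)

variable (Z) in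
lemma tildeP_closurePoint :
    (tildeP Z).app (op (graphClosure Z)) (closurePoint Z) = graphClosureι Z := by
  refine CartesianMonoidalCategory.hom_ext _ _ ?_ (CartesianMonoidalCategory.hom_ext _ _ ?_ ?_)
  · exact lift_fst _ _
  · rw [Category.assoc, Category.assoc]
    refine (lift_snd_assoc _ _ _).trans ((lift_fst _ _).trans ?_)
    refine hom_ext_of_pull (Z := Z) ?_
    exact pull_sec₁_interpMap (isInterpolating_graphClosureι Z)
  · rw [Category.assoc, Category.assoc]
    refine (lift_snd_assoc _ _ _).trans ((lift_snd _ _).trans ?_)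
    refine hom_ext_of_pull (Z := Z) ?_
    exact pull_sec₂_interpMap (isInterpolating_graphClosureι Z)

lemma ambientPull_univ (x : AmbientRing (Fn Z) k) :
    ambientPull (lift (univGm Z) (univPt Z) ≫ graphToA1 Z) x =
      (specFn k (Fn Z)[T;T⁻¹]).symm (ambientEval (LaurentPolynomial.T 1)
        (IsScalarTower.toAlgHom k (Fn Z) (Fn Z)[T;T⁻¹]) (coact Z) x) := by
  have : ambientPull (lift (univGm Z) (univPt Z) ≫ graphToA1 Z) =
      (specFn k (Fn Z)[T;T⁻¹]).symm.toAlgHom.comp (ambientEval (LaurentPolynomial.T 1)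
        (IsScalarTower.toAlgHom k (Fn Z) (Fn Z)[T;T⁻¹]) (coact Z)) := by
    rw [lift_graphToA1]
    refine ambient_hom_ext ?_ (fun a ↦ ?_) fun a ↦ ?_
    · rw [AlgHom.comp_apply, ambientPull, ambientEval_X, ambientEval_X, lift_fst, tFn_comp_gmToA1]
      exact gmUnit_univGm Z
    · rw [AlgHom.comp_apply, ambientPull, ambientEval_left, ambientEval_left, lift_snd_assoc,
        lift_fst, univPt, pull_ofFn]
      rfl
    · rw [AlgHom.comp_apply, ambientPull, ambientEval_right, ambientEval_right, lift_snd_assoc,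
        lift_snd]
      exact ((specFn k (Fn Z)[T;T⁻¹]).symm_apply_apply _).symm
  exact DFunLike.congr_fun this x

/-- For smooth `Z`, every morphism to `𝔸¹ × Z × Z` whose components are interpolating factors
through the closure of the graph. -/
lemma exists_comp_graphClosureι [Algebra.Smooth k (Fn Z)] (g : T ⟶ A1 k ⊗ Z ⊗ Z)
    (h : IsInterpolating (coact Z) (tFn (g ≫ fst _ _)) (pull (g ≫ snd _ _ ≫ fst _ _))
      (pull (g ≫ snd _ _ ≫ snd _ _))) : ∃ f : T ⟶ graphClosure Z, f ≫ graphClosureι Z = g := by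
  -- A function vanishing on the closure vanishes on the universal orbit triple, hence on every
  -- interpolating triple.
  have hker : RingHom.ker (pull (graphClosureι Z)) ≤ RingHom.ker (pull g) := by
    intro x hx
    obtain ⟨d, rfl⟩ := ambientPull_id_surjective Z x
    rw [RingHom.mem_ker] at hx ⊢
    rw [pull_ambientPull, Category.comp_id] at hx ⊢
    refine h.ambientEval_eq_zero isCoaction_coact ?_
    apply (specFn k (Fn Z)[T;T⁻¹]).symm.injective
    rw [← ambientPull_univ, ← graphToClosure_graphClosureι, ← Category.assoc, ← pull_ambientPull,
      hx, map_zero, map_zero]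
  refine ⟨ofFn (AlgHom.liftOfSurjective (pull (graphClosureι Z)) pull_graphClosureι_surjective
    (pull g) hker), hom_ext_of_pull ?_⟩
  rw [pull_comp, pull_ofFn]
  exact AlgHom.liftOfSurjective_comp _ _ _ _

end Graph

/-! ### The isomorphism between `Z̃` and the closure of the graph. -/

section Representability

variable {Z : Sch k} [ModObj (Gm k) Z] [IsAffine Z.left] {S : Sch k}

lemma tildeP_injective : Function.Injective ((tildeP Z).app (op S)) := by
  intro p q h
  have h' : lift p.t (lift (secS sec₁_hyp p.t ≫ p.f) (secS sec₂_hyp p.t ≫ p.f)) =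
    lift q.t (lift (secS sec₁_hyp q.t ≫ q.f) (secS sec₂_hyp q.t ≫ q.f)) := h
  refine TildePoint.ext_of_sec ?_ ?_ ?_
  · simpa using congrArg (fun g ↦ g ≫ fst _ _) h'
  · simpa using congrArg (fun g ↦ g ≫ snd _ _ ≫ fst _ _) h'
  · simpa using congrArg (fun g ↦ g ≫ snd _ _ ≫ snd _ _) h'

lemma exists_comp_eq_tildeP [Algebra.Smooth k (Fn Z)] (p : TildePoint Z S) :
    ∃ f : S ⟶ graphClosure Z, f ≫ graphClosureι Z = (tildeP Z).app (op S) p := by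
  refine exists_comp_graphClosureι
    (lift p.t (lift (secS sec₁_hyp p.t ≫ p.f) (secS sec₂_hyp p.t ≫ p.f))) ?_
  rw [lift_fst, lift_snd_assoc, lift_snd_assoc, lift_fst, lift_snd]
  exact p.isInterpolating

variable (Z) in
/-- The morphism from the closure of the graph to `Z̃` defined by the tautological point. -/
def closureToTilde : yoneda.obj (graphClosure Z) ⟶ tilde Z := yonedaEquiv.symm (closurePoint Z)

variable (Z) in
lemma closureToTilde_tildeP : closureToTilde Z ≫ tildeP Z = yoneda.map (graphClosureι Z) := by
  apply yonedaEquiv.injective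
  rw [yonedaEquiv_comp, yonedaEquiv_yoneda_map]
  refine Eq.trans (congrArg ((tildeP Z).app (op (graphClosure Z))) ?_) (tildeP_closurePoint Z)
  exact yonedaEquiv.apply_symm_apply _

/-- Composing with `p̃` gives the monomorphism `graphClosureι`, whence injectivity. For
surjectivity, `p̃` of any point factors through the closure, and `p̃` is injective. -/
lemma isIso_closureToTilde [Algebra.Smooth k (Fn Z)] : IsIso (closureToTilde Z) := by
  rw [NatTrans.isIso_iff_isIso_app]
  intro S
  have key (f : S.unop ⟶ graphClosure Z) :
      (tildeP Z).app S ((closureToTilde Z).app S f) = f ≫ graphClosureι Z :=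
    congrArg (fun e ↦ e.app S f) (closureToTilde_tildeP Z)
  rw [isIso_iff_bijective]
  refine ⟨fun f f' h ↦ ?_, fun p ↦ ?_⟩
  · rw [← cancel_mono (graphClosureι Z)]
    exact (key f).symm.trans ((congrArg ((tildeP Z).app S) h).trans (key f'))
  · obtain ⟨f, hf⟩ := exists_comp_eq_tildeP p
    exact ⟨f, tildeP_injective ((key f).trans hf)⟩

end Representability

end GmInterpolation
end
open GmInterpolation in
theorem proposition2p11 (k : Type u) [Field k] (Z : Over (Spec (CommRingCat.of k)))
    [ModObj (Gm k) Z] (h_affine : IsAffine Z.left) (h_smooth : Smooth Z.hom) :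
    ∃ e : tilde Z ≅ yoneda.obj (graphClosure Z),
      e.hom ≫ yoneda.map (graphClosureι Z) = tildeP Z := by

  have := smooth_fn Z h_smooth
  have := isIso_closureToTilde (Z := Z)
  refine ⟨(asIso (closureToTilde Z)).symm, ?_⟩
  rw [← closureToTilde_tildeP]
  exact IsIso.inv_hom_id_assoc _ _
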